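/- Let $\lambda>0$, $0<\alpha<1$, $\beta>0$, and let $B(n)\in\mathbb{N}$ satisfy $B(n)\sim\beta\lambda^{-1}n^{\alpha}$ as $n\to\infty$. Let $G^{(n)}\sim\mathrm{ER}_n(\lambda n^{-\alpha})$ be an Erdős–Rényi graph on $[n]$ (each pair of vertices is joined independently with probability $\lambda n^{-\alpha}$, for all $n$ large enough that this is at most $1$), let the costs $W_v$, $v\in[n]$, be i.i.d. uniform on $[0,1]$, let the starting vertex $v_1$ be uniform in $[n]$, and let these three be independent. Approximate gradient descent with block size $B=B(n)$ runs as follows. At step $1$ it is at $v_1$ and the other $n-1$ vertices are unexplored. At step $i\ge1$, being at $v_i$, it examines the next $B$ (in increasing order of label; or all, if fewer are left) of those unexplored vertices that it has not yet examined from the vertex $v_i$ since arriving there. The neighbours of $v_i$ among them form the partial neighbourhood $\mathcal N_i$; they become explored. If some vertex of $\mathcal N_i$ has smaller cost than $v_i$, then $v_{i+1}$ is the vertex of smallest cost in $\mathcal N_i$, and the examination of the unexplored vertices starts afresh from it; otherwise $v_{i+1}=v_i$. Let $X_i^{(n)}=W_{v_i}$, let $U_i^{(n)}$ be the number of unexplored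 vertices at step $i$ (so $U_1^{(n)}=n-1$ and $U_{i+1}^{(n)}=U_i^{(n)}-|\mathcal N_i|$), and let $E_i^{(n)}=|\mathcal N_i|$. The algorithm runs until it has examined every unexplored vertex from its current vertex without finding a smaller cost, that is, until $$\mathcal S^{(n)}=\inf\Big\{i\ge n/B:\ \exists\,j\ge1\text{ with } i=j+\lceil U_j^{(n)}/B\rceil\text{ and }X_i^{(n)}=X_j^{(n)}\Big\},\qquad \mathcal E^{(n)}=\sum_{i=1}^{\mathcal S^{(n)}}E_i^{(n)} .$$ Then, for all sufficiently large $n$, the set defining $\mathcal S^{(n)}$ is almost surely non-empty and $\mathcal S^{(n)}$ and $\mathcal E^{(n)}$ are integrable, and, as $n\to\infty$, $$\mathbb E\big(\mathcal S^{(n)}\big)=\frac{\lambda}{\beta}\,e^{\gamma}\,n^{1-\alpha}\,(1+o(1)),\qquad \mathbb E\big(\mathcal E^{(n)}\big)=\lambda\,e^{\gamma}\,n^{1-\alpha}\,(1+o(1)),$$ where $\gamma$ is the Euler–Mascheroni constant. -/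

import Mathlib

open MeasureTheory ProbabilityTheory Filter Asymptotics
open scoped Topology unitInterval

noncomputable section

namespace AGD

/-- Configuration of approximate gradient descent on the vertex set `Fin n`:
the vertex `cur` the algorithm is at, the set `unexplored` of vertices that have not belonged to
any partial neighbourhood visited so far (and are not the starting vertex), and the set `pending`
of those unexplored vertices whose adjacency to `cur` has not been examined yet. -/
structure State (n : ℕ) where
  cur : Fin n
  unexplored : Finset (Fin n)
  pending : Finset (Fin n)

/-- The starting configuration at the vertex `v`: every other vertex is unexplored and pending. -/
def State.init {n : ℕ} (v : Fin n) : State n where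
  cur := v
  unexplored := Finset.univ.erase v
  pending := Finset.univ.erase v

/-- The block of vertices examined in the next step: the first `B` pending vertices in increasing
order, or all pending vertices if there are fewer than `B` of them. -/
def State.block {n : ℕ} (B : ℕ) (s : State n) : Finset (Fin n) :=
  s.pending.filter fun w => (s.pending.filter fun u => u < w).card < B

open Classical in
/-- The partial neighbourhood of the current vertex: its neighbours within the block. -/
def State.partialNbhd {n : ℕ} (G : SimpleGraph (Fin n)) (B : ℕ) (s : State n) : Finset (Fin n) :=
  (s.block B).filter fun w => G.Adj s.cur w

open Classical in
/-- The vertices of smallest cost of the partial neighbourhood, if that cost is smaller than the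
cost of the current vertex; otherwise the empty set. -/
def State.better {n : ℕ} (G : SimpleGraph (Fin n)) (W : Fin n → ℝ) (B : ℕ) (s : State n) :
    Finset (Fin n) :=
  (s.partialNbhd G B).filter fun w =>
    W w < W s.cur ∧ ∀ u ∈ s.partialNbhd G B, W w ≤ W u

open Classical in
/-- One step. The partial neighbourhood becomes explored. If it has a vertex cheaper than the
current one, the algorithm moves to its cheapest vertex (ties, which have probability zero, go to
the smallest label), and all the vertices that are still unexplored are to be examined from there.
Otherwise the algorithm stays and the examined block is no longer pending. -/
def State.step {n : ℕ} (G : SimpleGraph (Fin n)) (W : Fin n → ℝ) (B : ℕ) (s : State n) :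
    State n :=
  if h : (s.better G W B).Nonempty then
    { cur := (s.better G W B).min' h
      unexplored := s.unexplored \ s.partialNbhd G B
      pending := s.unexplored \ s.partialNbhd G B }
  else
    { cur := s.cur
      unexplored := s.unexplored \ s.partialNbhd G B
      pending := s.pending \ s.block B }

/-- The sample space: a graph, the costs of the vertices, and the starting vertex. -/
abbrev Sample (n : ℕ) : Type := SimpleGraph (Fin n) × (Fin n → ℝ) × Fin n

/-- The configuration at step `i ≥ 1`; step `1` is the starting configuration. -/
def config {n : ℕ} (B : ℕ) (ω : Sample n) (i : ℕ) : State n :=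
  (State.step ω.1 ω.2.1 B)^[i - 1] (State.init ω.2.2)

/-- `X i`, the cost of the vertex the algorithm is at during step `i`. -/
def X {n : ℕ} (B : ℕ) (ω : Sample n) (i : ℕ) : ℝ :=
  ω.2.1 (config B ω i).cur

/-- `U i`, the number of unexplored vertices at step `i`. -/
def U {n : ℕ} (B : ℕ) (ω : Sample n) (i : ℕ) : ℕ :=
  (config B ω i).unexplored.card

/-- `E i`, the number of vertices explored during step `i`: the size of the `i`-th partial
neighbourhood. -/
def E {n : ℕ} (B : ℕ) (ω : Sample n) (i : ℕ) : ℕ :=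
  ((config B ω i).partialNbhd ω.1 B).card

/-- The times `i ≥ n / B` for which there is a step `j = i - ⌈U j / B⌉ ≥ 1` such that
`X i = X (i - ⌈U j / B⌉)`: the algorithm has stayed at the same vertex for `⌈U j / B⌉` steps since
step `j`, so that it has examined from this vertex everything that was unexplored at step `j`. -/
def stoppingSet {n : ℕ} (B : ℕ) (ω : Sample n) : Set ℕ :=
  {i : ℕ | (n : ℝ) / (B : ℝ) ≤ (i : ℝ) ∧
    ∃ j : ℕ, 1 ≤ j ∧ j + ⌈(U B ω j : ℝ) / (B : ℝ)⌉₊ = i ∧ X B ω i = X B ω j}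

/-- The running time, i.e. the number of steps of the algorithm. -/
def stepsTotal {n : ℕ} (B : ℕ) (ω : Sample n) : ℕ := sInf (stoppingSet B ω)

/-- The total number of explored vertices. -/
def exploredTotal {n : ℕ} (B : ℕ) (ω : Sample n) : ℕ :=
  ∑ i ∈ Finset.Icc 1 (stepsTotal B ω), E B ω i

/-- The connection probability `lam * n ^ (-α)`, truncated to `[0, 1]` (which only matters for
finitely many `n`). -/
def edgeProb (lam α : ℝ) (n : ℕ) : I :=
  Set.projIcc (0 : ℝ) 1 zero_le_one (lam * (n : ℝ) ^ (-α))

/-- The law of the model: an Erdős–Rényi graph with edge probability `lam * n ^ (-α)`, costs that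
are i.i.d. uniform on `[0, 1]`, and a uniform starting vertex, all independent. -/
def law (lam α : ℝ) (n : ℕ) : Measure (Sample n) :=
  (SimpleGraph.binomialRandom (Fin n) (edgeProb lam α n)).prod
    ((Measure.pi fun _ : Fin n => (volume.restrict (Set.Icc (0 : ℝ) 1))).prod
      (uniformOn (Set.univ : Set (Fin n))))

end AGD

end

/-!
The edges and costs are revealed only when the algorithm looks at them. Resampling the edges from
the current vertex to its block, and then the costs of the neighbours found, turns one step of the
algorithm into a recursion for the mean reward, in which a vertex of cost `x` keeps the algorithm
through a block of size `B` with probability `a = (1 - p * x) ^ B`.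

If exactly `R` blocks had to be examined from every later vertex, the mean number of steps with `r`
blocks pending would be `(∑_{k < r} a ^ k) * exp (∑_{k ≤ R} (1 - a ^ k) / k)`. This function is
compared with the actual recursion. Padding the number of blocks by a constant, to make up for the
last block not being full, gives an upper bound; giving up once noticeably many vertices are
explored, which has small probability by Markov's inequality, gives a lower bound. Integrated over
the uniform starting cost, both are `exp (H_R)` to leading order, with `H_R` the harmonic number and
`R` close to `n / B`, and `exp (H_R) / R` tends to `exp γ`. The explored vertices make up a
proportion `p` of the examined ones in the mean, and `p * B` tends to `β`.
-/

noncomputable section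

namespace AGD

open scoped ENNReal

variable {n : ℕ}

/-- The configuration after a step that explores `A` without leaving the current vertex. -/
def State.stay (B : ℕ) (s : State n) (A : Finset (Fin n)) : State n where
  cur := s.cur
  unexplored := s.unexplored \ A
  pending := s.pending \ s.block B

/-- The configuration after a step that explores `A` and moves to `w`. -/
def State.jump (s : State n) (A : Finset (Fin n)) (w : Fin n) : State n where
  cur := w
  unexplored := s.unexplored \ A
  pending := s.unexplored \ A

/-- The invariant of the algorithm: the current vertex is explored, and pending vertices are
unexplored. -/
def State.Valid (s : State n) : Prop := s.cur ∉ s.unexplored ∧ s.pending ⊆ s.unexplored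

/-- The vertex `w` is the one to move to from a vertex of cost `x` with partial neighbourhood `A`:
it has the smallest cost in `A`, ties going to the smallest label, and this cost is below `x`.
Ties are kept, rather than discarded as a null event, so that every step of the algorithm is a stay
or a jump to exactly one best vertex. -/
def IsBest (W : Fin n → ℝ) (x : ℝ) (A : Finset (Fin n)) (w : Fin n) : Prop :=
  W w < x ∧ ∀ u ∈ A.erase w, if u < w then W w < W u else W w ≤ W u

section Step

variable {G : SimpleGraph (Fin n)} {W W' : Fin n → ℝ} {x : ℝ} {A : Finset (Fin n)} {w w' : Fin n}
  {B : ℕ} {s : State n}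

lemma IsBest.le (hb : IsBest W x A w) {u : Fin n} (hu : u ∈ A) : W w ≤ W u := by
  have := hb.2 u
  grind

lemma IsBest.le_of_cost_eq (hb : IsBest W x A w) {u : Fin n} (hu : u ∈ A) (h : W u = W w) :
    w ≤ u := by
  have := hb.2 u
  grind

lemma IsBest.unique (hw : w ∈ A) (hw' : w' ∈ A) (hb : IsBest W x A w) (hb' : IsBest W x A w') :
    w = w' := by
  have hcost : W w = W w' := (hb.le hw').antisymm (hb'.le hw)
  exact (hb.le_of_cost_eq hw' hcost.symm).antisymm (hb'.le_of_cost_eq hw hcost)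

lemma IsBest.congr (hw : w ∈ A) (h : ∀ u ∈ A, W u = W' u) (hb : IsBest W x A w) :
    IsBest W' x A w := by
  refine ⟨h w hw ▸ hb.1, fun u hu => ?_⟩
  rw [← h w hw, ← h u (Finset.mem_of_mem_erase hu)]
  exact hb.2 u hu

lemma forall_le_or_exists_isBest (W : Fin n → ℝ) (x : ℝ) (A : Finset (Fin n)) :
    (∀ u ∈ A, x ≤ W u) ∨ ∃ w ∈ A, IsBest W x A w := by
  refine or_iff_not_imp_left.2 fun h => ?_
  push Not at h
  obtain ⟨u, hu, hux⟩ := h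
  obtain ⟨w, hw, hmin⟩ := A.exists_min_image (fun v => toLex (W v, v)) ⟨u, hu⟩
  simp only [Prod.Lex.toLex_le_toLex] at hmin
  refine ⟨w, hw, ?_, fun v hv => ?_⟩
  · grind
  · have := hmin v (Finset.mem_of_mem_erase hv)
    grind

lemma State.block_subset (B : ℕ) (s : State n) : s.block B ⊆ s.pending :=
  Finset.filter_subset _ _

lemma card_filter_card_filter_lt {ι : Type*} [LinearOrder ι] (S : Finset ι) (k : ℕ) :
    (S.filter fun w => (S.filter fun u => u < w).card < k).card = min S.card k := by
  induction S using Finset.induction_on_max with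
  | empty => simp
  | insert a S ha ih =>
    have ha' : a ∉ S := fun h => lt_irrefl a (ha a h)
    have rank_of_mem : ∀ w ∈ S,
        (insert a S).filter (fun u => u < w) = S.filter fun u => u < w := fun w hw => by
      rw [Finset.filter_insert, if_neg (ha w hw).not_gt]
    have rank_self : (insert a S).filter (fun u => u < a) = S := by
      rw [Finset.filter_insert, if_neg (lt_irrefl a), Finset.filter_true_of_mem ha]
    rw [Finset.filter_insert, rank_self, Finset.card_insert_of_notMem ha',
      Finset.filter_congr fun w hw => by rw [rank_of_mem w hw]]
    split_ifs with h
    · rw [Finset.card_insert_of_notMem (by simp [ha']), ih]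
      omega
    · rw [ih]
      omega

lemma State.card_block (B : ℕ) (s : State n) : (s.block B).card = min s.pending.card B :=
  card_filter_card_filter_lt _ _

lemma State.card_stay_pending (B : ℕ) (s : State n) (A : Finset (Fin n)) :
    (s.stay B A).pending.card = s.pending.card - B := by
  rw [State.stay, Finset.card_sdiff_of_subset (s.block_subset B), s.card_block]
  omega

lemma State.mem_partialNbhd : w ∈ s.partialNbhd G B ↔ w ∈ s.block B ∧ G.Adj s.cur w := by
  classical
  exact Finset.mem_filter

lemma State.mem_better : w ∈ s.better G W B ↔
    w ∈ s.partialNbhd G B ∧ W w < W s.cur ∧ ∀ u ∈ s.partialNbhd G B, W w ≤ W u := by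
  classical
  exact Finset.mem_filter

lemma State.partialNbhd_subset_block (G : SimpleGraph (Fin n)) (B : ℕ) (s : State n) :
    s.partialNbhd G B ⊆ s.block B := fun _ hw => (State.mem_partialNbhd.1 hw).1

lemma State.Valid.block_subset (hs : s.Valid) (B : ℕ) : s.block B ⊆ s.unexplored :=
  (State.block_subset B s).trans hs.2

lemma State.Valid.partialNbhd_subset (hs : s.Valid) (G : SimpleGraph (Fin n)) (B : ℕ) :
    s.partialNbhd G B ⊆ s.unexplored :=
  (s.partialNbhd_subset_block G B).trans (hs.block_subset B)

lemma State.step_eq_jump (hw : w ∈ s.partialNbhd G B)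
    (hb : IsBest W (W s.cur) (s.partialNbhd G B) w) :
    s.step G W B = s.jump (s.partialNbhd G B) w := by
  have hmem : w ∈ s.better G W B := State.mem_better.2 ⟨hw, hb.1, fun u hu => hb.le hu⟩
  have hmin : (s.better G W B).min' ⟨w, hmem⟩ = w := by
    refine le_antisymm (Finset.min'_le _ _ hmem) (Finset.le_min' _ _ _ fun u hu => ?_)
    obtain ⟨hu, -, hule⟩ := State.mem_better.1 hu
    exact hb.le_of_cost_eq hu ((hule w hw).antisymm (hb.le hu))
  rw [State.step, dif_pos ⟨w, hmem⟩, hmin]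
  rfl

lemma State.step_eq_stay (h : ∀ u ∈ s.partialNbhd G B, W s.cur ≤ W u) :
    s.step G W B = s.stay B (s.partialNbhd G B) := by
  have hne : ¬ (s.better G W B).Nonempty := by
    rintro ⟨w, hw⟩
    obtain ⟨hw, hlt, -⟩ := State.mem_better.1 hw
    exact (h w hw).not_gt hlt
  rw [State.step, dif_neg hne]
  rfl

lemma State.step_cases (G : SimpleGraph (Fin n)) (W : Fin n → ℝ) (B : ℕ) (s : State n) :
    s.step G W B = s.stay B (s.partialNbhd G B) ∨
      ∃ w ∈ s.partialNbhd G B, W w < W s.cur ∧ s.step G W B = s.jump (s.partialNbhd G B) w := by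
  rcases forall_le_or_exists_isBest W (W s.cur) (s.partialNbhd G B) with h | ⟨w, hw, hb⟩
  · exact Or.inl (State.step_eq_stay h)
  · exact Or.inr ⟨w, hw, hb.1, State.step_eq_jump hw hb⟩

open Classical in
lemma State.apply_step (φ : State n → ℝ≥0∞) (G : SimpleGraph (Fin n)) (W : Fin n → ℝ) (B : ℕ)
    (s : State n) :
    φ (s.step G W B) =
      (if ∀ u ∈ s.partialNbhd G B, W s.cur ≤ W u then φ (s.stay B (s.partialNbhd G B)) else 0) +
        ∑ w ∈ s.partialNbhd G B, if IsBest W (W s.cur) (s.partialNbhd G B) w then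
          φ (s.jump (s.partialNbhd G B) w) else 0 := by
  rcases forall_le_or_exists_isBest W (W s.cur) (s.partialNbhd G B) with h | ⟨w, hw, hb⟩
  · rw [State.step_eq_stay h, if_pos h, Finset.sum_eq_zero, add_zero]
    exact fun w hw => if_neg fun hb => (h w hw).not_gt hb.1
  · rw [State.step_eq_jump hw hb, if_neg fun h => (h w hw).not_gt hb.1, zero_add,
      Finset.sum_eq_single_of_mem w hw fun w' hw' hne => if_neg fun hb' =>
        hne (hb'.unique hw' hw hb), if_pos hb]

lemma State.step_unexplored (G : SimpleGraph (Fin n)) (W : Fin n → ℝ) (B : ℕ) (s : State n) :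
    (s.step G W B).unexplored = s.unexplored \ s.partialNbhd G B := by
  rcases s.step_cases G W B with h | ⟨w, -, -, h⟩ <;> rw [h] <;> rfl

lemma State.Valid.stay (hs : s.Valid) (hA : A ⊆ s.block B) : (s.stay B A).Valid := by
  refine ⟨fun h => hs.1 (Finset.sdiff_subset h), fun w hw => ?_⟩
  simp only [State.stay, Finset.mem_sdiff] at hw ⊢
  exact ⟨hs.2 hw.1, fun h => hw.2 (hA h)⟩

lemma State.valid_jump (s : State n) (hw : w ∈ A) : (s.jump A w).Valid :=
  ⟨by simp [State.jump, hw], subset_rfl⟩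

lemma State.Valid.step (hs : s.Valid) (G : SimpleGraph (Fin n)) (W : Fin n → ℝ) (B : ℕ) :
    (s.step G W B).Valid := by
  rcases s.step_cases G W B with h | ⟨w, hw, -, h⟩ <;> rw [h]
  · exact hs.stay (s.partialNbhd_subset_block G B)
  · exact s.valid_jump hw

lemma State.valid_init (v : Fin n) : (State.init v).Valid :=
  ⟨by simp [State.init], subset_rfl⟩

lemma State.card_init_unexplored (v : Fin n) : (State.init v).unexplored.card = n - 1 := by
  simp [State.init]

lemma State.Valid.card_step_unexplored (hs : s.Valid) (G : SimpleGraph (Fin n)) (W : Fin n → ℝ)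
    (B : ℕ) : (s.step G W B).unexplored.card + (s.partialNbhd G B).card = s.unexplored.card := by
  rw [s.step_unexplored]
  exact Finset.card_sdiff_add_card_eq_card (hs.partialNbhd_subset G B)

lemma State.partialNbhd_eq_empty (h : s.pending = ∅) (G : SimpleGraph (Fin n)) (B : ℕ) :
    s.partialNbhd G B = ∅ := by
  rw [← Finset.subset_empty, ← h]
  exact (s.partialNbhd_subset_block G B).trans (s.block_subset B)

lemma State.step_of_pending_eq_empty (h : s.pending = ∅) (G : SimpleGraph (Fin n))
    (W : Fin n → ℝ) (B : ℕ) : s.step G W B = s := by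
  have hnbhd := State.partialNbhd_eq_empty h G B
  rw [State.step_eq_stay (by simp [hnbhd]), hnbhd]
  cases s
  simp_all [State.stay]

end Step

section Run

variable {G : SimpleGraph (Fin n)} {W : Fin n → ℝ} {B : ℕ} {s : State n}

/-- A potential that decreases at every step until no vertex is pending: lexicographic in the
numbers of unexplored and of pending vertices, since a jump can only increase the latter at the
price of the former. -/
def State.potential (s : State n) : ℕ := s.unexplored.card * (n + 1) + s.pending.card

lemma State.potential_init_le (v : Fin n) : (State.init v).potential ≤ (n + 1) ^ 2 := by
  have hcard : (Finset.univ.erase v).card ≤ n := (Finset.card_le_univ _).trans (by simp)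
  simp only [State.potential, State.init]
  nlinarith

lemma State.potential_stay_lt (h : s.pending.Nonempty) (hB : 1 ≤ B) (A : Finset (Fin n)) :
    (s.stay B A).potential < s.potential := by
  have hunexplored : (s.stay B A).unexplored.card ≤ s.unexplored.card :=
    Finset.card_le_card Finset.sdiff_subset
  have hpending := s.card_stay_pending B A
  have := h.card_pos
  have := Nat.mul_le_mul_right (n + 1) hunexplored
  unfold State.potential
  omega

lemma State.potential_jump_lt {A : Finset (Fin n)} (hA : A ⊆ s.unexplored) {w : Fin n}
    (hw : w ∈ A) : (s.jump A w).potential < s.potential := by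
  have hunexplored : (s.jump A w).unexplored.card + A.card = s.unexplored.card :=
    Finset.card_sdiff_add_card_eq_card hA
  have hpending : (s.jump A w).pending.card ≤ n := (Finset.card_le_univ _).trans (by simp)
  have hpos : 0 < A.card := Finset.card_pos.2 ⟨w, hw⟩
  unfold State.potential
  nlinarith

lemma State.Valid.potential_step_lt (hs : s.Valid) (h : s.pending.Nonempty) (hB : 1 ≤ B)
    (G : SimpleGraph (Fin n)) (W : Fin n → ℝ) : (s.step G W B).potential < s.potential := by
  rcases s.step_cases G W B with h' | ⟨w, hw, -, h'⟩ <;> rw [h']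
  · exact State.potential_stay_lt h hB _
  · exact State.potential_jump_lt (hs.partialNbhd_subset G B) hw

lemma State.Valid.iterate (hs : s.Valid) (i : ℕ) : ((State.step G W B)^[i] s).Valid := by
  induction i with
  | zero => exact hs
  | succ i ih => rw [Function.iterate_succ_apply']; exact ih.step G W B

lemma iterate_of_pending_eq_empty (h : s.pending = ∅) (i : ℕ) : (State.step G W B)^[i] s = s :=
  Function.iterate_fixed (State.step_of_pending_eq_empty h G W B) i

lemma State.Valid.pending_iterate_eq_empty (hs : s.Valid) (hB : 1 ≤ B) {N : ℕ}
    (hN : s.potential ≤ N) : ((State.step G W B)^[N] s).pending = ∅ := by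
  induction N generalizing s with
  | zero =>
    rw [State.potential] at hN
    exact Finset.card_eq_zero.1 (by rw [Function.iterate_zero_apply]; omega)
  | succ N ih =>
    rcases s.pending.eq_empty_or_nonempty with h | h
    · rw [iterate_of_pending_eq_empty h, h]
    · have := hs.potential_step_lt h hB G W
      exact ih (hs.step G W B) (by omega)

lemma cost_step_le (s : State n) : W (s.step G W B).cur ≤ W s.cur := by
  rcases s.step_cases G W B with h | ⟨w, -, hw, h⟩ <;> rw [h]
  · exact le_rfl
  · exact hw.le

lemma cost_iterate_le (s : State n) (i : ℕ) : W ((State.step G W B)^[i] s).cur ≤ W s.cur := by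
  induction i with
  | zero => exact le_rfl
  | succ i ih => rw [Function.iterate_succ_apply']; exact (cost_step_le _).trans ih

lemma card_pending_iterate_of_cost_eq {r : ℕ}
    (h : W ((State.step G W B)^[r] s).cur = W s.cur) :
    ((State.step G W B)^[r] s).pending.card = s.pending.card - r * B := by
  induction r generalizing s with
  | zero => simp
  | succ r ih =>
    rw [Function.iterate_succ_apply] at h ⊢
    have hstep : W (s.step G W B).cur = W s.cur :=
      (cost_step_le s).antisymm (h ▸ cost_iterate_le _ r)
    rw [ih (h.trans hstep.symm)]
    rcases s.step_cases G W B with h' | ⟨w, -, hw, h'⟩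
    · rw [h', State.card_stay_pending, Nat.sub_sub, add_mul, one_mul, add_comm]
    · rw [h'] at hstep
      exact absurd hstep hw.ne

lemma State.Valid.card_unexplored_le_card_unexplored_iterate (hs : s.Valid) (i : ℕ) :
    s.unexplored.card ≤ ((State.step G W B)^[i] s).unexplored.card + i * B := by
  induction i with
  | zero => simp
  | succ i ih =>
    have hcard := (hs.iterate (G := G) (W := W) (B := B) i).card_step_unexplored G W B
    have hnbhd := Finset.card_le_card
      (State.partialNbhd_subset_block G B ((State.step G W B)^[i] s))
    rw [State.card_block] at hnbhd
    rw [Function.iterate_succ_apply', add_mul]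
    omega

lemma exists_arrival (hs : s.pending = s.unexplored) (i : ℕ) :
    ∃ j ≤ i, W ((State.step G W B)^[i] s).cur = W ((State.step G W B)^[j] s).cur ∧
      ((State.step G W B)^[i] s).pending.card =
        ((State.step G W B)^[j] s).unexplored.card - (i - j) * B := by
  induction i with
  | zero => exact ⟨0, le_rfl, rfl, by simp [hs]⟩
  | succ i ih =>
    obtain ⟨j, hj, hW, hp⟩ := ih
    rw [Function.iterate_succ_apply']
    rcases ((State.step G W B)^[i] s).step_cases G W B with h' | ⟨w, -, -, h'⟩
    · refine ⟨j, by omega, by rw [h']; exact hW, ?_⟩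
      rw [h', State.card_stay_pending, hp, Nat.sub_sub, Nat.sub_add_comm hj, add_mul, one_mul]
    · refine ⟨i + 1, le_rfl, by rw [Function.iterate_succ_apply'], ?_⟩
      rw [Function.iterate_succ_apply', h']
      simp [State.jump]

lemma State.Valid.sum_card_partialNbhd (hs : s.Valid) (N : ℕ) :
    ∑ i ∈ Finset.range N, (((State.step G W B)^[i] s).partialNbhd G B).card +
      ((State.step G W B)^[N] s).unexplored.card = s.unexplored.card := by
  induction N with
  | zero => simp
  | succ N ih =>
    have := (hs.iterate (G := G) (W := W) (B := B) N).card_step_unexplored G W B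
    rw [Finset.sum_range_succ, Function.iterate_succ_apply']
    omega

end Run

section StoppingTime

variable {B : ℕ} {ω : Sample n}

/-- The number of steps that the algorithm needs to run out of pending vertices; the stopping rule
of `stoppingSet` takes effect one step later. -/
def exhaustionTime (B : ℕ) (ω : Sample n) : ℕ := sInf {t | (config B ω (t + 1)).pending = ∅}

lemma config_succ (B : ℕ) (ω : Sample n) (i : ℕ) :
    config B ω (i + 1) = (State.step ω.1 ω.2.1 B)^[i] (State.init ω.2.2) := rfl

lemma config_add_succ (B : ℕ) (ω : Sample n) (i k : ℕ) :
    config B ω (i + k + 1) = (State.step ω.1 ω.2.1 B)^[k] (config B ω (i + 1)) := by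
  rw [config_succ, config_succ, add_comm, Function.iterate_add_apply]

lemma pending_config_of_potential_le (hB : 1 ≤ B) (ω : Sample n) {N : ℕ}
    (hN : (State.init ω.2.2).potential ≤ N) : (config B ω (N + 1)).pending = ∅ :=
  (State.valid_init ω.2.2).pending_iterate_eq_empty hB hN

lemma exhaustionTime_le (hB : 1 ≤ B) (ω : Sample n) : exhaustionTime B ω ≤ (n + 1) ^ 2 :=
  Nat.sInf_le (pending_config_of_potential_le hB ω (State.potential_init_le _))

lemma pending_config_exhaustionTime (hB : 1 ≤ B) (ω : Sample n) :
    (config B ω (exhaustionTime B ω + 1)).pending = ∅ :=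
  Nat.sInf_mem (s := {t | (config B ω (t + 1)).pending = ∅})
    ⟨_, pending_config_of_potential_le hB ω le_rfl⟩

lemma config_of_exhaustionTime_le (hB : 1 ≤ B) {i : ℕ} (hi : exhaustionTime B ω ≤ i) :
    config B ω (i + 1) = config B ω (exhaustionTime B ω + 1) := by
  obtain ⟨k, rfl⟩ := Nat.exists_eq_add_of_le hi
  rw [config_add_succ, iterate_of_pending_eq_empty (pending_config_exhaustionTime hB ω)]

lemma pending_config_eq_empty_iff (hB : 1 ≤ B) {i : ℕ} :
    (config B ω (i + 1)).pending = ∅ ↔ exhaustionTime B ω ≤ i :=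
  ⟨fun h => Nat.sInf_le h, fun h => by
    rw [config_of_exhaustionTime_le hB h, pending_config_exhaustionTime hB]⟩

lemma ceil_div_natCast_le_iff (hB : 1 ≤ B) {u r : ℕ} : ⌈(u : ℝ) / B⌉₊ ≤ r ↔ u ≤ r * B := by
  rw [Nat.ceil_le, div_le_iff₀ (by exact_mod_cast hB)]
  norm_cast

lemma add_succ_mem_stoppingSet (hB : 1 ≤ B) {j r : ℕ}
    (hr : ⌈(U B ω (j + 1) : ℝ) / B⌉₊ = r) (hX : X B ω (j + r + 1) = X B ω (j + 1)) :
    j + r + 1 ∈ stoppingSet B ω := by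
  refine ⟨Nat.ceil_le.1 ((ceil_div_natCast_le_iff hB).2 ?_), j + 1, by omega, by omega, hX⟩
  have hU : U B ω (j + 1) ≤ r * B := (ceil_div_natCast_le_iff hB).1 hr.le
  have hinit := (State.valid_init ω.2.2).card_unexplored_le_card_unexplored_iterate
    (G := ω.1) (W := ω.2.1) (B := B) j
  rw [State.card_init_unexplored] at hinit
  change n - 1 ≤ U B ω (j + 1) + j * B at hinit
  rw [add_mul, add_mul]
  omega

lemma exhaustionTime_lt_of_mem_stoppingSet (hB : 1 ≤ B) {i : ℕ} (hi : i ∈ stoppingSet B ω) :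
    exhaustionTime B ω < i := by
  obtain ⟨-, j, hj, rfl, hX⟩ := hi
  obtain ⟨j, rfl⟩ := Nat.exists_eq_add_of_le' hj
  set r := ⌈(U B ω (j + 1) : ℝ) / B⌉₊
  rw [show j + 1 + r = j + r + 1 by omega] at hX ⊢
  have hU : U B ω (j + 1) ≤ r * B := (ceil_div_natCast_le_iff hB).1 le_rfl
  have hvalid : (config B ω (j + 1)).Valid := (State.valid_init ω.2.2).iterate j
  have hpending : (config B ω (j + 1)).pending.card ≤ r * B :=
    (Finset.card_le_card hvalid.2).trans hU
  simp only [X, config_add_succ] at hX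
  rw [Nat.lt_succ_iff, ← pending_config_eq_empty_iff hB, ← Finset.card_eq_zero, config_add_succ,
    card_pending_iterate_of_cost_eq hX]
  omega

lemma cost_config_antitone (B : ℕ) (ω : Sample n) : Antitone fun i => X B ω (i + 1) :=
  antitone_nat_of_succ_le fun i => by
    simp only [X]
    rw [config_add_succ B ω i 1]
    exact cost_step_le _

lemma exhaustionTime_succ_mem_stoppingSet (hB : 1 ≤ B) (ω : Sample n) :
    exhaustionTime B ω + 1 ∈ stoppingSet B ω := by
  obtain ⟨j, hj, hX, hpending⟩ := exists_arrival (G := ω.1) (W := ω.2.1) (B := B)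
    (s := State.init ω.2.2) rfl (exhaustionTime B ω)
  simp only [← config_succ, pending_config_exhaustionTime hB, Finset.card_empty] at hX hpending
  set r := ⌈(U B ω (j + 1) : ℝ) / B⌉₊ with hr
  have hle : r ≤ exhaustionTime B ω - j :=
    (ceil_div_natCast_le_iff hB).2 (Nat.sub_eq_zero_iff_le.1 hpending.symm)
  have hXr : X B ω (j + r + 1) = X B ω (j + 1) :=
    (cost_config_antitone B ω (Nat.le_add_right j r)).antisymm
      (hX.symm.trans_le (cost_config_antitone B ω (show j + r ≤ exhaustionTime B ω by omega)))
  have hmem := add_succ_mem_stoppingSet hB hr.symm hXr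
  have := exhaustionTime_lt_of_mem_stoppingSet hB hmem
  rwa [show exhaustionTime B ω = j + r by omega]

lemma stepsTotal_eq_exhaustionTime_succ (hB : 1 ≤ B) (ω : Sample n) :
    stepsTotal B ω = exhaustionTime B ω + 1 :=
  le_antisymm (Nat.sInf_le (exhaustionTime_succ_mem_stoppingSet hB ω))
    (le_csInf ⟨_, exhaustionTime_succ_mem_stoppingSet hB ω⟩ fun _ hi =>
      exhaustionTime_lt_of_mem_stoppingSet hB hi)

end StoppingTime

section Reward

variable {B : ℕ}

/-- The total reward of a run of `N` steps from the configuration `s`: every step earns the running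
reward `ρ q`, where `q` is the number of pending vertices before the step, and the end of the run
earns the terminal reward `τ u`, where `u` is the number of vertices that are then unexplored. The
running time and the number of explored vertices are both of this form. -/
def reward (ρ τ : ℕ → ℝ≥0∞) (B : ℕ) : ℕ → State n → SimpleGraph (Fin n) → (Fin n → ℝ) → ℝ≥0∞
  | 0, s, _, _ => τ s.unexplored.card
  | N + 1, s, G, W => ρ s.pending.card + reward ρ τ B N (s.step G W B) G W

/-- The running reward that counts the steps with a pending vertex. -/
def stepCount (q : ℕ) : ℝ≥0∞ := if 0 < q then 1 else 0

/-- The terminal reward that counts the vertices explored since the start. -/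
def exploredCount (n u : ℕ) : ℝ≥0∞ := (n - 1 - u : ℕ)

lemma reward_eq_sum (ρ τ : ℕ → ℝ≥0∞) (B N : ℕ) (s : State n) (G : SimpleGraph (Fin n))
    (W : Fin n → ℝ) :
    reward ρ τ B N s G W = ∑ i ∈ Finset.range N, ρ ((State.step G W B)^[i] s).pending.card +
      τ ((State.step G W B)^[N] s).unexplored.card := by
  induction N generalizing s with
  | zero => simp [reward]
  | succ N ih =>
    rw [reward, ih, Finset.sum_range_succ']
    simp only [Function.iterate_succ_apply, Function.iterate_zero_apply]
    ring

lemma stepsTotal_eq_reward (hB : 1 ≤ B) (ω : Sample n) :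
    (stepsTotal B ω : ℝ≥0∞) = 1 + reward stepCount (fun _ => 0) B ((n + 1) ^ 2)
      (State.init ω.2.2) ω.1 ω.2.1 := by
  have hpending (i : ℕ) : 0 < (config B ω (i + 1)).pending.card ↔ i < exhaustionTime B ω := by
    rw [Finset.card_pos, Finset.nonempty_iff_ne_empty, Ne, pending_config_eq_empty_iff hB, not_le]
  have hfilter : (Finset.range ((n + 1) ^ 2)).filter (· < exhaustionTime B ω) =
      Finset.range (exhaustionTime B ω) := by
    have := exhaustionTime_le hB ω
    ext i
    simp only [Finset.mem_filter, Finset.mem_range]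
    omega
  simp only [stepsTotal_eq_exhaustionTime_succ hB, reward_eq_sum, stepCount, ← config_succ,
    hpending, ← Finset.sum_filter, hfilter, Finset.sum_const, Finset.card_range, nsmul_one,
    add_zero, Nat.cast_add, Nat.cast_one, add_comm]

lemma exploredTotal_eq_reward (hB : 1 ≤ B) (ω : Sample n) :
    (exploredTotal B ω : ℝ≥0∞) = reward (fun _ => 0) (exploredCount n) B ((n + 1) ^ 2)
      (State.init ω.2.2) ω.1 ω.2.1 := by
  have hsum := (State.valid_init ω.2.2).sum_card_partialNbhd (G := ω.1) (W := ω.2.1) (B := B)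
    (exhaustionTime B ω + 1)
  have hE : exploredTotal B ω = ∑ i ∈ Finset.range (exhaustionTime B ω + 1), E B ω (i + 1) := by
    rw [exploredTotal, stepsTotal_eq_exhaustionTime_succ hB, Finset.range_eq_Ico,
      Finset.sum_Ico_add', zero_add]
    rfl
  rw [State.card_init_unexplored, ← config_succ, config_of_exhaustionTime_le hB (Nat.le_succ _)]
    at hsum
  rw [reward_eq_sum, Finset.sum_const_zero, zero_add, ← config_succ,
    config_of_exhaustionTime_le hB (exhaustionTime_le hB ω), exploredCount, hE]
  simp only [E, config_succ] at hsum ⊢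
  congr 1
  omega

end Reward

section Pi

variable {ι : Type*} [Fintype ι] [DecidableEq ι] {Ω : ι → Type*} [∀ i, MeasurableSpace (Ω i)]
  (μ : ∀ i, Measure (Ω i)) [∀ i, IsProbabilityMeasure (μ i)]

lemma lintegral_pi_eq_lintegral_update {f : (∀ i, Ω i) → ℝ≥0∞} (hf : Measurable f) (i : ι) :
    ∫⁻ x, f x ∂Measure.pi μ = ∫⁻ x, ∫⁻ y, f (Function.update x i y) ∂μ i ∂Measure.pi μ := by
  have h : (fun x => ∫⁻ y, f (Function.update x i y) ∂μ i) = ∫⋯∫⁻_{i}, f ∂μ :=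
    (lmarginal_singleton f i).symm
  refine lintegral_eq_of_lmarginal_eq {i} hf (by rw [h]; exact hf.lmarginal μ) ?_
  rw [lmarginal_singleton, lmarginal_singleton]
  ext x
  simp

lemma lintegral_pi_prod_mul {F : (∀ i, Ω i) → ℝ≥0∞} (hF : Measurable F)
    {g : ∀ i, Ω i → ℝ≥0∞} (hg : ∀ i, Measurable (g i)) (A : Finset ι)
    (hA : ∀ i ∈ A, ∀ x t, F (Function.update x i t) = F x) :
    ∫⁻ x, (∏ i ∈ A, g i (x i)) * F x ∂Measure.pi μ =
      (∏ i ∈ A, ∫⁻ y, g i y ∂μ i) * ∫⁻ x, F x ∂Measure.pi μ := by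
  have hmeas (A : Finset ι) : Measurable fun x : ∀ i, Ω i => (∏ i ∈ A, g i (x i)) * F x := by
    fun_prop
  induction A using Finset.induction_on with
  | empty => simp
  | insert a A ha ih =>
    have hupdate (x : ∀ i, Ω i) (y : Ω a) :
        (∏ i ∈ insert a A, g i (Function.update x a y i)) * F (Function.update x a y) =
          g a y * ((∏ i ∈ A, g i (x i)) * F x) := by
      rw [Finset.prod_insert ha, hA a (Finset.mem_insert_self _ _), Function.update_self, mul_assoc,
        Finset.prod_congr rfl fun i hi => by
          rw [Function.update_of_ne (ne_of_mem_of_not_mem hi ha)]]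
    rw [lintegral_pi_eq_lintegral_update μ (hmeas _) a]
    simp only [hupdate]
    simp only [lintegral_mul_const _ (hg a)]
    rw [lintegral_const_mul _ (hmeas _), ih fun i hi => hA i (Finset.mem_insert_of_mem hi),
      Finset.prod_insert ha, mul_assoc]

lemma lintegral_pi_ite_forall_mem {F : (∀ i, Ω i) → ℝ≥0∞} (hF : Measurable F)
    {J : ∀ i, Set (Ω i)} (hJ : ∀ i, MeasurableSet (J i)) (A : Finset ι)
    [∀ x : ∀ i, Ω i, Decidable (∀ i ∈ A, x i ∈ J i)]
    (hA : ∀ i ∈ A, ∀ x t, F (Function.update x i t) = F x) :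
    ∫⁻ x, (if ∀ i ∈ A, x i ∈ J i then F x else 0) ∂Measure.pi μ =
      (∏ i ∈ A, μ i (J i)) * ∫⁻ x, F x ∂Measure.pi μ := by
  classical
  have hprod (x : ∀ i, Ω i) : (if ∀ i ∈ A, x i ∈ J i then F x else 0) =
      (∏ i ∈ A, (J i).indicator 1 (x i)) * F x := by
    simp only [Set.indicator_apply, Pi.one_apply, Finset.prod_ite_zero, Finset.prod_const_one,
      ite_mul, one_mul, zero_mul]
  simp only [hprod]
  rw [lintegral_pi_prod_mul μ hF (fun i => measurable_one.indicator (hJ i)) A hA]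
  simp only [lintegral_indicator_one (hJ _)]

end Pi

section RandomSubset

variable {ι : Type*}

/-- The probability that a random subset of `S`, which contains each element independently with
probability `p`, equals `A`. -/
def subsetWeight (p : ℝ) (S A : Finset ι) : ℝ≥0∞ :=
  ENNReal.ofReal (p ^ A.card * (1 - p) ^ (S.card - A.card))

variable [DecidableEq ι] {p : ℝ} {w : ι} {S A : Finset ι}

lemma subsetWeight_insert_left (hp : p ≤ 1) (hw : w ∉ S) (hA : A ⊆ S) :
    subsetWeight p (insert w S) A = ENNReal.ofReal (1 - p) * subsetWeight p S A := by
  have hcard := Finset.card_le_card hA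
  rw [subsetWeight, subsetWeight, ← ENNReal.ofReal_mul (by linarith),
    Finset.card_insert_of_notMem hw, show S.card + 1 - A.card = S.card - A.card + 1 by omega]
  ring_nf

lemma subsetWeight_insert_insert (hp : 0 ≤ p) (hw : w ∉ S) (hA : A ⊆ S) :
    subsetWeight p (insert w S) (insert w A) = ENNReal.ofReal p * subsetWeight p S A := by
  rw [subsetWeight, subsetWeight, ← ENNReal.ofReal_mul hp, Finset.card_insert_of_notMem hw,
    Finset.card_insert_of_notMem fun h => hw (hA h), Nat.add_sub_add_right]
  ring_nf

end RandomSubset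

section Graph

variable {V : Type*}

instance [Countable V] : MeasurableSingletonClass (SimpleGraph V) where
  measurableSet_singleton G := by
    have : {G} = SimpleGraph.edgeSet ⁻¹' {G.edgeSet} := by
      ext G'; simp
    rw [this]
    exact SimpleGraph.measurable_edgeSet (measurableSet_singleton _)

/-- The graph `G` with the neighbours of `v` within `b` replaced by those of `A`. It serves to
resample the edges between the current vertex and the block under examination. -/
def setNbhd (G : SimpleGraph V) (v : V) (b A : Finset V) : SimpleGraph V where
  Adj x y := x ≠ y ∧ ((x = v ∧ y ∈ b ∧ y ∈ A) ∨ (y = v ∧ x ∈ b ∧ x ∈ A) ∨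
    (¬ (x = v ∧ y ∈ b) ∧ ¬ (y = v ∧ x ∈ b) ∧ G.Adj x y))
  symm := ⟨fun x y h => by have := G.adj_comm x y; tauto⟩
  loopless := ⟨fun _ h => h.1 rfl⟩

lemma setNbhd_adj_iff {G : SimpleGraph V} {v w : V} {b A : Finset V} (hv : v ∉ b) (hw : w ∈ b) :
    (setNbhd G v b A).Adj v w ↔ w ∈ A := by
  simp only [setNbhd]
  grind

lemma setNbhd_adj_iff_of_ne {G : SimpleGraph V} {v x y : V} {b A : Finset V}
    (hx : x = v → y ∉ b) (hy : y = v → x ∉ b) : (setNbhd G v b A).Adj x y ↔ G.Adj x y := by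
  have := G.ne_of_adj (a := x) (b := y)
  simp only [setNbhd]
  tauto

lemma setNbhd_empty (G : SimpleGraph V) (v : V) (A : Finset V) : setNbhd G v ∅ A = G := by
  ext x y
  exact setNbhd_adj_iff_of_ne (by simp) (by simp)

lemma fromEdgeSet_update [DecidableEq V] (ω : Sym2 V → Prop) {v w : V} {P : Prop} {A : Finset V}
    (hA : w ∈ A ↔ P) :
    SimpleGraph.fromEdgeSet {e | Function.update ω s(v, w) P e} =
      setNbhd (SimpleGraph.fromEdgeSet {e | ω e}) v {w} A := by
  ext x y
  simp only [SimpleGraph.fromEdgeSet_adj, Set.mem_ofPred_eq, setNbhd, Finset.mem_singleton, ne_eq]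
  by_cases hxy : s(x, y) = s(v, w)
  · rw [hxy, Function.update_self]
    grind
  · rw [Function.update_of_ne hxy]
    grind

lemma setNbhd_setNbhd_singleton [DecidableEq V] (G : SimpleGraph V) {v w : V} {b A C : Finset V}
    (hw : w ∉ b) : setNbhd (setNbhd G v {w} C) v b A =
      setNbhd G v (insert w b) ((A ∩ b) ∪ (C ∩ {w})) := by
  ext x y
  simp only [setNbhd]
  grind

variable (p : I) (f : SimpleGraph V → ℝ≥0∞) {v w : V}

lemma lintegral_binomialRandom [Fintype V] :
    ∫⁻ G, f G ∂SimpleGraph.binomialRandom V p =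
      ∫⁻ ω : Sym2 V → Prop, f (SimpleGraph.fromEdgeSet {e | ω e}) ∂Measure.pi fun e : Sym2 V =>
        unitInterval.toNNReal p • Measure.dirac (e ∈ Sym2.diagSetᶜ) +
          unitInterval.toNNReal (σ p) • Measure.dirac False := by
  have hmeas : Measurable fun ω : Sym2 V → Prop => ({e | ω e} : Set (Sym2 V)) :=
    MeasurableEquiv.setOfPred.measurable
  rw [SimpleGraph.binomialRandom_eq_map, setBernoulli_eq_map, Measure.infinitePi_eq_pi,
    lintegral_map (measurable_of_countable f) SimpleGraph.measurable_fromEdgeSet,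
    lintegral_map (measurable_of_countable _) hmeas]

variable [Finite V]

lemma lintegral_binomialRandom_eq_add_setNbhd_singleton (hvw : v ≠ w) :
    ∫⁻ G, f G ∂SimpleGraph.binomialRandom V p =
      ENNReal.ofReal p * ∫⁻ G, f (setNbhd G v {w} {w}) ∂SimpleGraph.binomialRandom V p +
      ENNReal.ofReal (1 - p) * ∫⁻ G, f (setNbhd G v {w} ∅) ∂SimpleGraph.binomialRandom V p := by
  classical
  have := Fintype.ofFinite V
  have hmeas (g : (Sym2 V → Prop) → ℝ≥0∞) : Measurable g := measurable_of_countable _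
  have hdiag : (s(v, w) ∈ (Sym2.diagSet : Set (Sym2 V))ᶜ) = True := by simpa using hvw
  rw [lintegral_binomialRandom, lintegral_binomialRandom, lintegral_binomialRandom,
    lintegral_pi_eq_lintegral_update _ (hmeas _) s(v, w), ← lintegral_const_mul _ (hmeas _),
    ← lintegral_const_mul _ (hmeas _), ← lintegral_add_left (hmeas _)]
  refine lintegral_congr fun ω => ?_
  rw [lintegral_add_measure, lintegral_smul_measure, lintegral_smul_measure, hdiag,
    lintegral_dirac, lintegral_dirac, fromEdgeSet_update ω (A := {w}) (by simp),
    fromEdgeSet_update ω (A := ∅) (by simp)]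
  have hp : ENNReal.ofReal p = (unitInterval.toNNReal p : ℝ≥0∞) :=
    ENNReal.ofReal_coe_nnreal (p := unitInterval.toNNReal p)
  have hσ : ENNReal.ofReal (1 - p) = (unitInterval.toNNReal (σ p) : ℝ≥0∞) :=
    ENNReal.ofReal_coe_nnreal (p := unitInterval.toNNReal (σ p))
  rw [hp, hσ]
  rfl

lemma lintegral_binomialRandom_eq_sum_setNbhd {b : Finset V} (hv : v ∉ b) :
    ∫⁻ G, f G ∂SimpleGraph.binomialRandom V p =
      ∑ A ∈ b.powerset,
        subsetWeight p b A * ∫⁻ G, f (setNbhd G v b A) ∂SimpleGraph.binomialRandom V p := by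
  classical
  induction b using Finset.induction_on with
  | empty => simp [setNbhd_empty, subsetWeight]
  | insert w b hw ih =>
    rw [Finset.mem_insert, not_or] at hv
    rw [ih hv.2, Finset.sum_powerset_insert hw, ← Finset.sum_add_distrib]
    refine Finset.sum_congr rfl fun A hA => ?_
    rw [Finset.mem_powerset] at hA
    have hone : A ∩ b ∪ {w} ∩ {w} = insert w A := by grind
    have hzero : A ∩ b ∪ ∅ ∩ {w} = A := by grind
    rw [lintegral_binomialRandom_eq_add_setNbhd_singleton p _ hv.1]
    simp only [setNbhd_setNbhd_singleton _ hw, hone, hzero]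
    rw [subsetWeight_insert_left p.2.2 hw hA, subsetWeight_insert_insert p.2.1 hw hA]
    ring

end Graph

section MeanReward

lemma State.step_congr {s : State n} {G G' : SimpleGraph (Fin n)} {W W' : Fin n → ℝ} {B : ℕ}
    (hnbhd : s.partialNbhd G B = s.partialNbhd G' B)
    (hW : ∀ u ∈ insert s.cur (s.partialNbhd G B), W u = W' u) : s.step G W B = s.step G' W' B := by
  simp only [Finset.mem_insert, forall_eq_or_imp] at hW
  have hbetter : s.better G W B = s.better G' W' B := by
    ext w
    rw [State.mem_better, State.mem_better, ← hnbhd, ← hW.1]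
    refine and_congr_right fun hw => ?_
    rw [← hW.2 w hw]
    exact and_congr_right fun _ => forall₂_congr fun u hu => by rw [← hW.2 u hu]
  simp only [State.step, hbetter, hnbhd]

variable (ρ τ : ℕ → ℝ≥0∞) (B : ℕ) (p : I) (N : ℕ) {s : State n}

lemma reward_congr (hs : s.Valid) {G G' : SimpleGraph (Fin n)} {W W' : Fin n → ℝ}
    (hcur : ∀ w ∈ s.pending, G.Adj s.cur w ↔ G'.Adj s.cur w)
    (hadj : ∀ u ∈ s.unexplored, ∀ w ∈ s.unexplored, G.Adj u w ↔ G'.Adj u w)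
    (hW : ∀ u ∈ insert s.cur s.unexplored, W u = W' u) :
    reward ρ τ B N s G W = reward ρ τ B N s G' W' := by
  induction N generalizing s with
  | zero => rfl
  | succ N ih =>
    have hnbhd : s.partialNbhd G B = s.partialNbhd G' B := by
      ext w
      rw [State.mem_partialNbhd, State.mem_partialNbhd]
      exact and_congr_right fun hw => hcur w (s.block_subset B hw)
    have hsub := hs.partialNbhd_subset G B
    have hstep : s.step G W B = s.step G' W' B :=
      State.step_congr hnbhd fun u hu => hW u (Finset.insert_subset_insert _ hsub hu)
    have hdrop {C : Finset (Fin n)} (u : Fin n) (hu : u ∈ s.unexplored \ C) : u ∈ s.unexplored :=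
      Finset.sdiff_subset hu
    rw [reward, reward, ← hstep]
    congr 1
    rcases s.step_cases G W B with h | ⟨w, hw, -, h⟩
    · rw [h]
      exact ih (hs.stay (s.partialNbhd_subset_block G B))
        (fun w hw => hcur w (Finset.sdiff_subset hw))
        (fun u hu w hw => hadj u (hdrop u hu) w (hdrop w hw))
        fun u hu => hW u (Finset.insert_subset_insert _ Finset.sdiff_subset hu)
    · rw [h]
      exact ih (s.valid_jump hw) (fun u hu => hadj w (hsub hw) u (hdrop u hu))
        (fun u hu w hw => hadj u (hdrop u hu) w (hdrop w hw))
        fun u hu => hW u (Finset.mem_insert_of_mem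
          (Finset.insert_subset (hsub hw) Finset.sdiff_subset hu))

lemma measurableSet_isBest {x : (Fin n → ℝ) → ℝ} (hx : Measurable x) (A : Finset (Fin n))
    (w : Fin n) : MeasurableSet {W : Fin n → ℝ | IsBest W (x W) A w} := by
  have hite (u : Fin n) :
      MeasurableSet {W : Fin n → ℝ | if u < w then W w < W u else W w ≤ W u} := by
    split_ifs
    · exact measurableSet_lt (measurable_pi_apply w) (measurable_pi_apply u)
    · exact measurableSet_le (measurable_pi_apply w) (measurable_pi_apply u)
  simp only [IsBest, Set.ofPred_and, Set.ofPred_forall]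
  exact (measurableSet_lt (measurable_pi_apply w) hx).inter
    (Finset.measurableSet_biInter _ fun u _ => hite u)

lemma measurableSet_forall_le {x : (Fin n → ℝ) → ℝ} (hx : Measurable x) (A : Finset (Fin n)) :
    MeasurableSet {W : Fin n → ℝ | ∀ u ∈ A, x W ≤ W u} := by
  simp only [Set.ofPred_forall]
  exact Finset.measurableSet_biInter _ fun u _ => measurableSet_le hx (measurable_pi_apply u)

lemma measurable_reward_right (s : State n) (G : SimpleGraph (Fin n)) :
    Measurable (reward ρ τ B N s G) := by
  classical
  induction N generalizing s with
  | zero => exact measurable_const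
  | succ N ih =>
    have happly (W : Fin n → ℝ) := s.apply_step (fun s' => reward ρ τ B N s' G W) G W B
    refine measurable_const.add ?_
    simp only [happly]
    refine Measurable.add ?_ (Finset.measurable_sum _ fun w _ => ?_)
    · exact (ih _).ite (measurableSet_forall_le (measurable_pi_apply _) _) measurable_const
    · exact (ih _).ite (measurableSet_isBest (measurable_pi_apply _) _ _) measurable_const

lemma measurable_reward (s : State n) :
    Measurable fun z : (Fin n → ℝ) × SimpleGraph (Fin n) => reward ρ τ B N s z.2 z.1 :=
  measurable_from_prod_countable_left fun G => measurable_reward_right ρ τ B N s G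

/-- The mean reward of a run from `s` for given costs `W`: the expectation over the random graph. -/
def meanRewardOfCosts (s : State n) (W : Fin n → ℝ) : ℝ≥0∞ :=
  ∫⁻ G, reward ρ τ B N s G W ∂SimpleGraph.binomialRandom (Fin n) p

lemma measurable_meanRewardOfCosts (s : State n) : Measurable (meanRewardOfCosts ρ τ B p N s) :=
  (measurable_reward ρ τ B N s).lintegral_prod_right'

lemma measurable_meanRewardOfCosts_update (s : State n) (u : Fin n) (x : ℝ) :
    Measurable fun W => meanRewardOfCosts ρ τ B p N s (Function.update W u x) :=
  (measurable_meanRewardOfCosts ρ τ B p N s).comp measurable_update_left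

lemma meanRewardOfCosts_update (hs : s.Valid) {u : Fin n} (hcur : u ≠ s.cur)
    (hu : u ∉ s.unexplored) (W : Fin n → ℝ) (t : ℝ) :
    meanRewardOfCosts ρ τ B p N s (Function.update W u t) = meanRewardOfCosts ρ τ B p N s W := by
  refine lintegral_congr fun G => reward_congr ρ τ B N hs (fun _ _ => Iff.rfl)
    (fun _ _ _ _ => Iff.rfl) fun v hv => Function.update_of_ne ?_ _ _
  rintro rfl
  simp_all

lemma State.Valid.cur_notMem_block (hs : s.Valid) : s.cur ∉ s.block B :=
  fun h => hs.1 (hs.block_subset B h)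

lemma State.Valid.partialNbhd_setNbhd (hs : s.Valid) (G : SimpleGraph (Fin n)) {B : ℕ}
    {A : Finset (Fin n)} (hA : A ⊆ s.block B) :
    s.partialNbhd (setNbhd G s.cur (s.block B) A) B = A := by
  ext w
  rw [State.mem_partialNbhd]
  exact ⟨fun hw => (setNbhd_adj_iff (hs.cur_notMem_block B) hw.1).1 hw.2,
    fun hw => ⟨hA hw, (setNbhd_adj_iff (hs.cur_notMem_block B) (hA hw)).2 hw⟩⟩

/- The configuration that follows does not look at the resampled edges any more. -/
open Classical in
lemma reward_step_setNbhd (hs : s.Valid) (G : SimpleGraph (Fin n)) (W : Fin n → ℝ)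
    {A : Finset (Fin n)} (hA : A ⊆ s.block B) :
    reward ρ τ B N (s.step (setNbhd G s.cur (s.block B) A) W B)
        (setNbhd G s.cur (s.block B) A) W =
      (if ∀ u ∈ A, W s.cur ≤ W u then reward ρ τ B N (s.stay B A) G W else 0) +
        ∑ w ∈ A, if IsBest W (W s.cur) A w then reward ρ τ B N (s.jump A w) G W else 0 := by
  have hadj : ∀ u ∈ s.unexplored, ∀ w ∈ s.unexplored,
      (setNbhd G s.cur (s.block B) A).Adj u w ↔ G.Adj u w := fun u hu w hw =>
    setNbhd_adj_iff_of_ne (fun h => absurd (h ▸ hu) hs.1) fun h => absurd (h ▸ hw) hs.1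
  have hunexplored : ∀ u ∈ s.unexplored \ A, ∀ w ∈ s.unexplored \ A,
      (setNbhd G s.cur (s.block B) A).Adj u w ↔ G.Adj u w := fun u hu w hw =>
    hadj u (Finset.sdiff_subset hu) w (Finset.sdiff_subset hw)
  have hstay := reward_congr ρ τ B N (hs.stay hA) (W := W)
    (fun w hw => setNbhd_adj_iff_of_ne (fun _ => (Finset.mem_sdiff.1 hw).2)
      fun _ => hs.cur_notMem_block B) hunexplored fun _ _ => rfl
  have hjump (w : Fin n) (hw : w ∈ A) := reward_congr ρ τ B N (s.valid_jump hw) (W := W)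
    (fun u hu => hadj w (hs.block_subset B (hA hw)) u (Finset.sdiff_subset hu)) hunexplored
    fun _ _ => rfl
  rw [State.apply_step fun s' => reward ρ τ B N s' (setNbhd G s.cur (s.block B) A) W,
    hs.partialNbhd_setNbhd G hA, hstay]
  congr 1
  exact Finset.sum_congr rfl fun w hw => by rw [hjump w hw]

open Classical in
lemma meanRewardOfCosts_succ (hs : s.Valid) (W : Fin n → ℝ) :
    meanRewardOfCosts ρ τ B p (N + 1) s W = ρ s.pending.card + ∑ A ∈ (s.block B).powerset,
      subsetWeight p (s.block B) A *
        ((if ∀ u ∈ A, W s.cur ≤ W u then meanRewardOfCosts ρ τ B p N (s.stay B A) W else 0) +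
          ∑ w ∈ A, if IsBest W (W s.cur) A w then
            meanRewardOfCosts ρ τ B p N (s.jump A w) W else 0) := by
  have hmeas (f : SimpleGraph (Fin n) → ℝ≥0∞) : Measurable f := measurable_of_countable f
  simp only [meanRewardOfCosts, reward]
  rw [lintegral_add_left measurable_const, lintegral_const, measure_univ, mul_one,
    lintegral_binomialRandom_eq_sum_setNbhd p (fun G => reward ρ τ B N (s.step G W B) G W)
      (hs.cur_notMem_block B)]
  congr 1
  refine Finset.sum_congr rfl fun A hA => ?_
  simp only [reward_step_setNbhd ρ τ B N hs _ W (Finset.mem_powerset.1 hA)]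
  rw [lintegral_add_left (hmeas _), lintegral_finsetSum _ fun _ _ => hmeas _]
  congr 2
  · split_ifs <;> simp
  · refine Finset.sum_congr rfl fun w _ => ?_
    split_ifs <;> simp

/-- The uniform law on the unit interval. -/
abbrev unif : Measure ℝ := volume.restrict (Set.Icc (0 : ℝ) 1)

instance : IsProbabilityMeasure unif := ⟨by simp⟩

lemma unif_Ici {x : ℝ} (hx : 0 ≤ x) : unif (Set.Ici x) = ENNReal.ofReal (1 - x) := by
  have hinter : Set.Ici x ∩ Set.Icc 0 1 = Set.Icc x 1 := by grind
  rw [Measure.restrict_apply measurableSet_Ici, hinter, Real.volume_Icc]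

lemma unif_Ioi {x : ℝ} (hx : 0 ≤ x) : unif (Set.Ioi x) = ENNReal.ofReal (1 - x) :=
  (measure_congr Ioi_ae_eq_Ici).trans (unif_Ici hx)

/-- The law of the costs. -/
abbrev costLaw (n : ℕ) : Measure (Fin n → ℝ) := Measure.pi fun _ : Fin n => unif

/-- The mean reward of a run from `s` when the current vertex has cost `x`: the expectation over
the random graph and the costs of the other vertices. The cost of the current vertex is sampled as
well, but then overwritten by `x`. -/
def meanReward (s : State n) (x : ℝ) : ℝ≥0∞ :=
  ∫⁻ W, meanRewardOfCosts ρ τ B p N s (Function.update W s.cur x) ∂costLaw n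

lemma measurable_meanReward (s : State n) : Measurable (meanReward ρ τ B p N s) := by
  have : Measurable fun z : ℝ × (Fin n → ℝ) =>
      meanRewardOfCosts ρ τ B p N s (Function.update z.2 s.cur z.1) := by
    exact (measurable_meanRewardOfCosts ρ τ B p N s).comp (measurable_update'.comp measurable_swap)
  exact this.lintegral_prod_right'

open Classical in
lemma lintegral_stay (hs : s.Valid) {x : ℝ} (hx : 0 ≤ x) {A : Finset (Fin n)}
    (hA : A ⊆ s.block B) :
    ∫⁻ W, (if ∀ u ∈ A, x ≤ Function.update W s.cur x u then
        meanRewardOfCosts ρ τ B p N (s.stay B A) (Function.update W s.cur x) else 0) ∂costLaw n =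
      ENNReal.ofReal (1 - x) ^ A.card * meanReward ρ τ B p N (s.stay B A) x := by
  have hne (u : Fin n) (hu : u ∈ A) : u ≠ s.cur :=
    ne_of_mem_of_not_mem (hA hu) (hs.cur_notMem_block B)
  have hupdate (W : Fin n → ℝ) : (∀ u ∈ A, x ≤ Function.update W s.cur x u) ↔
      ∀ u ∈ A, W u ∈ Set.Ici x :=
    forall₂_congr fun u hu => by rw [Function.update_of_ne (hne u hu), Set.mem_Ici]
  simp only [hupdate]
  rw [lintegral_pi_ite_forall_mem _
    (measurable_meanRewardOfCosts_update ρ τ B p N _ _ _) (fun _ => measurableSet_Ici) A,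
    Finset.prod_const, unif_Ici hx]
  · rfl
  · intro u hu W t
    rw [Function.update_comm (hne u hu),
      meanRewardOfCosts_update ρ τ B p N (hs.stay hA) (hne u hu) (by simp [State.stay, hu])]

open Classical in
lemma lintegral_jump_of_cost_eq (s : State n) {A : Finset (Fin n)} {w : Fin n} (hw : w ∈ A)
    {x y : ℝ} (hy : 0 ≤ y) :
    ∫⁻ W, (if IsBest (Function.update W w y) x A w then
        meanRewardOfCosts ρ τ B p N (s.jump A w) (Function.update W w y) else 0) ∂costLaw n =
      (Set.Iio x).indicator (fun y => ENNReal.ofReal (1 - y) ^ (A.card - 1) *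
        meanReward ρ τ B p N (s.jump A w) y) y := by
  set J : Fin n → Set ℝ := fun u => if u < w then Set.Ioi y else Set.Ici y
  have hJ (u : Fin n) : MeasurableSet (J u) := by
    simp only [J]
    split_ifs
    exacts [measurableSet_Ioi, measurableSet_Ici]
  have hunif (u : Fin n) : unif (J u) = ENNReal.ofReal (1 - y) := by
    simp only [J]
    split_ifs
    exacts [unif_Ioi hy, unif_Ici hy]
  have hbest (W : Fin n → ℝ) :
      IsBest (Function.update W w y) x A w ↔ y < x ∧ ∀ u ∈ A.erase w, W u ∈ J u := by
    rw [IsBest, Function.update_self]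
    refine and_congr_right fun _ => forall₂_congr fun u hu => ?_
    rw [Function.update_of_ne (Finset.ne_of_mem_erase hu)]
    simp only [J]
    split_ifs <;> rfl
  by_cases hyx : y < x
  · simp only [hbest, hyx, true_and]
    rw [Set.indicator_of_mem (Set.mem_Iio.2 hyx), lintegral_pi_ite_forall_mem _
      (measurable_meanRewardOfCosts_update ρ τ B p N _ _ _) hJ]
    · simp only [hunif, Finset.prod_const, Finset.card_erase_of_mem hw]
      rfl
    · intro u hu W t
      obtain ⟨hne, hu⟩ := Finset.mem_erase.1 hu
      rw [Function.update_comm hne,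
        meanRewardOfCosts_update ρ τ B p N (s.valid_jump hw) hne (by simp [State.jump, hu])]
  · simp [hbest, hyx]

open Classical in
lemma lintegral_jump (hs : s.Valid) {x : ℝ} (hx : x ≤ 1) {A : Finset (Fin n)}
    (hA : A ⊆ s.block B) {w : Fin n} (hw : w ∈ A) :
    ∫⁻ W, (if IsBest (Function.update W s.cur x) x A w then
        meanRewardOfCosts ρ τ B p N (s.jump A w) (Function.update W s.cur x) else 0) ∂costLaw n =
      ∫⁻ y in Set.Ico 0 x, ENNReal.ofReal (1 - y) ^ (A.card - 1) *
        meanReward ρ τ B p N (s.jump A w) y := by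
  have hne (u : Fin n) (hu : u ∈ A) : u ≠ s.cur :=
    ne_of_mem_of_not_mem (hA hu) (hs.cur_notMem_block B)
  have hbest (W : Fin n → ℝ) : IsBest (Function.update W s.cur x) x A w ↔ IsBest W x A w :=
    ⟨fun h => h.congr hw fun u hu => Function.update_of_ne (hne u hu) _ _,
      fun h => h.congr hw fun u hu => (Function.update_of_ne (hne u hu) _ _).symm⟩
  have hcosts (W : Fin n → ℝ) := meanRewardOfCosts_update ρ τ B p N (s.valid_jump hw)
    (hne w hw).symm (fun h => hs.1 (Finset.sdiff_subset h)) W x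
  have hmeas : Measurable fun W : Fin n → ℝ =>
      if IsBest W x A w then meanRewardOfCosts ρ τ B p N (s.jump A w) W else 0 :=
    (measurable_meanRewardOfCosts ρ τ B p N _).ite (measurableSet_isBest measurable_const A w)
      measurable_const
  have hmeas' : Measurable (Function.uncurry fun (W : Fin n → ℝ) (y : ℝ) =>
      if IsBest (Function.update W w y) x A w then
        meanRewardOfCosts ρ τ B p N (s.jump A w) (Function.update W w y) else 0) :=
    hmeas.comp measurable_update'
  simp only [hbest, hcosts]
  rw [lintegral_pi_eq_lintegral_update _ hmeas w,
    lintegral_lintegral_swap hmeas'.aemeasurable,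
    setLIntegral_congr_fun measurableSet_Icc fun y hy =>
      lintegral_jump_of_cost_eq ρ τ B p N s hw hy.1,
    setLIntegral_indicator measurableSet_Iio, Set.inter_comm]
  congr 2
  ext y
  simp only [Set.mem_inter_iff, Set.mem_Icc, Set.mem_Iio, Set.mem_Ico]
  grind

lemma meanReward_succ (hs : s.Valid) {x : ℝ} (hx : x ∈ Set.Icc (0 : ℝ) 1) :
    meanReward ρ τ B p (N + 1) s x = ρ s.pending.card + ∑ A ∈ (s.block B).powerset,
      subsetWeight p (s.block B) A *
        (ENNReal.ofReal (1 - x) ^ A.card * meanReward ρ τ B p N (s.stay B A) x +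
          ∑ w ∈ A, ∫⁻ y in Set.Ico 0 x, ENNReal.ofReal (1 - y) ^ (A.card - 1) *
            meanReward ρ τ B p N (s.jump A w) y) := by
  classical
  have hstay (A : Finset (Fin n)) : Measurable fun W : Fin n → ℝ =>
      if ∀ u ∈ A, x ≤ Function.update W s.cur x u then
        meanRewardOfCosts ρ τ B p N (s.stay B A) (Function.update W s.cur x) else 0 :=
    ((measurable_meanRewardOfCosts ρ τ B p N _).ite (measurableSet_forall_le measurable_const A)
      measurable_const).comp measurable_update_left
  have hjump (A : Finset (Fin n)) (w : Fin n) : Measurable fun W : Fin n → ℝ =>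
      if IsBest (Function.update W s.cur x) x A w then
        meanRewardOfCosts ρ τ B p N (s.jump A w) (Function.update W s.cur x) else 0 :=
    ((measurable_meanRewardOfCosts ρ τ B p N _).ite (measurableSet_isBest measurable_const A w)
      measurable_const).comp measurable_update_left
  have hsum (A : Finset (Fin n)) : Measurable fun W : Fin n → ℝ =>
      (if ∀ u ∈ A, x ≤ Function.update W s.cur x u then
        meanRewardOfCosts ρ τ B p N (s.stay B A) (Function.update W s.cur x) else 0) +
      ∑ w ∈ A, if IsBest (Function.update W s.cur x) x A w then
        meanRewardOfCosts ρ τ B p N (s.jump A w) (Function.update W s.cur x) else 0 :=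
    (hstay A).add (Finset.measurable_sum A fun w _ => hjump A w)
  rw [meanReward]
  simp only [meanRewardOfCosts_succ ρ τ B p N hs, Function.update_self]
  rw [lintegral_add_left measurable_const, lintegral_const, measure_univ, mul_one,
    lintegral_finsetSum _ fun A _ => (hsum A).const_mul _]
  congr 1
  refine Finset.sum_congr rfl fun A hA => ?_
  rw [Finset.mem_powerset] at hA
  rw [lintegral_const_mul _ (hsum A), lintegral_add_left (hstay A),
    lintegral_finsetSum _ fun w _ => hjump A w, lintegral_stay ρ τ B p N hs hx.1 hA]
  congr 2
  exact Finset.sum_congr rfl fun w hw => lintegral_jump ρ τ B p N hs hx.2 hA hw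

end MeanReward

section GeometricSum

/-- The geometric sum `1 + a + ⋯ + a ^ (r - 1)`: the mean number of steps spent at a vertex from
which `r` blocks are to be examined, if a block keeps the algorithm there with probability `a`. -/
def geomSum (r : ℕ) (a : ℝ) : ℝ := ∑ k ∈ Finset.range r, a ^ k

/-- The exponential of `∑ k ∈ {1, …, R}, (1 - a ^ k) / k`. Times `geomSum r a` it solves the
recursion for the mean number of steps when `R` blocks are to be examined from each later vertex. -/
def expSum (R : ℕ) (a : ℝ) : ℝ :=
  Real.exp (∑ k ∈ Finset.range R, (1 - a ^ (k + 1)) / (k + 1 : ℝ))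

/-- The exponential of the `R`-th harmonic number. -/
def expHarmonic (R : ℕ) : ℝ := Real.exp (harmonic R)

lemma expHarmonic_pos (R : ℕ) : 0 < expHarmonic R := Real.exp_pos _

lemma expSum_one (R : ℕ) : expSum R 1 = 1 := by simp [expSum]

lemma expSum_eq (R : ℕ) (a : ℝ) :
    expSum R a = expHarmonic R * Real.exp (-∑ k ∈ Finset.range R, a ^ (k + 1) / (k + 1 : ℝ)) := by
  rw [expSum, expHarmonic, ← Real.exp_add, ← sub_eq_add_neg, harmonic, Rat.cast_sum,
    ← Finset.sum_sub_distrib]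
  push_cast
  simp only [sub_div, one_div]

lemma geomSum_succ (r : ℕ) (a : ℝ) : geomSum (r + 1) a = 1 + a * geomSum r a := by
  rw [geomSum, geomSum, geom_sum_succ, add_comm]

@[fun_prop]
lemma differentiable_geomSum (r : ℕ) : Differentiable ℝ (geomSum r) := by
  unfold geomSum
  fun_prop

@[fun_prop]
lemma continuous_expSum (R : ℕ) : Continuous (expSum R) := by
  unfold expSum
  fun_prop

variable (R : ℕ) {a b : ℝ}

lemma geomSum_nonneg (ha : 0 ≤ a) : 0 ≤ geomSum R a :=
  Finset.sum_nonneg fun k _ => pow_nonneg ha k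

lemma geomSum_mono {r r' : ℕ} (h : r ≤ r') (ha : 0 ≤ a) : geomSum r a ≤ geomSum r' a :=
  Finset.sum_le_sum_of_subset_of_nonneg (Finset.range_mono h) fun k _ _ => pow_nonneg ha k

lemma deriv_geomSum_le (ha : 0 ≤ a) : deriv (geomSum R) a ≤ geomSum R a ^ 2 := by
  induction R with
  | zero =>
    have : geomSum 0 = fun _ => 0 := by ext; simp [geomSum]
    simp [this]
  | succ R ih =>
    have hderiv : deriv (geomSum (R + 1)) a = geomSum R a + a * deriv (geomSum R) a := by
      rw [funext (geomSum_succ R), deriv_const_add, deriv_fun_mul (by fun_prop) (by fun_prop)]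
      simp
    have hmono := geomSum_mono R.le_succ ha
    have hnonneg := geomSum_nonneg R ha
    calc deriv (geomSum (R + 1)) a ≤ geomSum R a * (1 + a * geomSum R a) := by
          rw [hderiv]
          nlinarith
      _ ≤ geomSum (R + 1) a ^ 2 := by
          rw [← geomSum_succ]
          nlinarith

lemma hasDerivAt_sum_pow_div (a : ℝ) :
    HasDerivAt (fun a : ℝ => ∑ k ∈ Finset.range R, a ^ (k + 1) / (k + 1 : ℝ)) (geomSum R a) a := by
  refine HasDerivAt.fun_sum fun k _ => ?_
  refine ((hasDerivAt_pow (k + 1) a).div_const (k + 1 : ℝ)).congr_deriv ?_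
  rw [Nat.add_sub_cancel]
  push_cast
  field_simp

lemma hasDerivAt_expSum (a : ℝ) : HasDerivAt (expSum R) (-(geomSum R a * expSum R a)) a := by
  rw [expSum_eq, funext (expSum_eq R)]
  refine (((hasDerivAt_sum_pow_div R a).neg.exp).const_mul _).congr_deriv ?_
  simp only [Pi.neg_apply]
  ring

lemma geomSum_mul_expSum_le (ha : 0 ≤ a) : geomSum R a * expSum R a ≤ expHarmonic R := by
  have hderiv (a : ℝ) : HasDerivAt (fun a => geomSum R a * expSum R a)
      ((deriv (geomSum R) a - geomSum R a ^ 2) * expSum R a) a :=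
    ((differentiable_geomSum R a).hasDerivAt.mul (hasDerivAt_expSum R a)).congr_deriv (by ring)
  have hanti : AntitoneOn (fun a => geomSum R a * expSum R a) (Set.Ici 0) := by
    refine antitoneOn_of_deriv_nonpos (convex_Ici 0)
      (fun a _ => (hderiv a).continuousAt.continuousWithinAt)
      (fun a _ => (hderiv a).differentiableAt.differentiableWithinAt) fun a ha => ?_
    rw [(hderiv a).deriv]
    exact mul_nonpos_of_nonpos_of_nonneg
      (sub_nonpos.2 (deriv_geomSum_le R (interior_subset ha))) (Real.exp_nonneg _)
  have hzero : geomSum R 0 ≤ 1 := by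
    cases R with
    | zero => simp [geomSum]
    | succ R => simp [geomSum_succ]
  calc geomSum R a * expSum R a ≤ geomSum R 0 * expSum R 0 :=
        hanti (Set.self_mem_Ici) ha ha
    _ = geomSum R 0 * expHarmonic R := by simp [expSum_eq]
    _ ≤ expHarmonic R := mul_le_of_le_one_left (expHarmonic_pos R).le hzero

lemma one_le_expSum (ha₀ : 0 ≤ a) (ha : a ≤ 1) : 1 ≤ expSum R a := by
  rw [expSum, Real.one_le_exp_iff]
  refine Finset.sum_nonneg fun k _ => div_nonneg ?_ (by positivity)
  linarith [pow_le_one₀ (n := k + 1) ha₀ ha]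

lemma one_sub_mul_expHarmonic_le_expSum (ha₀ : 0 ≤ a) (ha : a ≤ 1) :
    (1 - a) * expHarmonic R ≤ expSum R a := by
  rcases ha.eq_or_lt with rfl | ha
  · simp [expSum]
  rw [expSum_eq, mul_comm]
  refine mul_le_mul_of_nonneg_left ?_ (expHarmonic_pos R).le
  rw [← Real.exp_log (sub_pos.2 ha), Real.exp_le_exp, le_neg]
  exact sum_le_hasSum _ (fun k _ => by positivity)
    (Real.hasSum_pow_div_log_of_abs_lt_one (by rwa [abs_of_nonneg ha₀]))

/- Three terms of the geometric sum absorb the `1` on the left: if `(1 - a) * expHarmonic R ≤ 1`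
then `a ≥ 2 / 3`, and otherwise `(1 - a) * expHarmonic R` bounds `expSum R a` from below. -/
lemma one_add_le_geomSum_mul_expSum (ha₀ : 0 ≤ a) (ha : a ≤ 1) (hab : a ≤ b)
    (hR : 3 ≤ a * expHarmonic R) :
    1 + (1 - b) * expHarmonic R ≤ geomSum 3 a * expSum R a := by
  have hM := expHarmonic_pos R
  have hone := one_le_expSum R ha₀ ha
  have hle := one_sub_mul_expHarmonic_le_expSum R ha₀ ha
  have hgeom : geomSum 3 a = 1 + (a + a ^ 2) := by simp [geomSum, Finset.sum_range_succ, add_assoc]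
  set M := expHarmonic R
  have hnonneg : 0 ≤ 1 + (a + a ^ 2) := by positivity
  have hb : (1 - b) * M ≤ (1 - a) * M := by gcongr
  rw [hgeom]
  rcases le_total ((1 - a) * M) 1 with h | h
  · have ha' : 2 / 3 ≤ a := by nlinarith
    calc 1 + (1 - b) * M ≤ 1 + (a + a ^ 2) := by nlinarith
      _ ≤ _ := le_mul_of_one_le_right hnonneg hone
  · have hkey : 1 ≤ (a + a ^ 2) * ((1 - a) * M) := by
      rcases le_total (2 / 3) a with h' | h'
      · nlinarith
      · have : 1 ≤ a * ((1 - a) * M) := by nlinarith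
        nlinarith [mul_nonneg (sq_nonneg a) (zero_le_one.trans h)]
    calc 1 + (1 - b) * M ≤ (1 + (a + a ^ 2)) * ((1 - a) * M) := by nlinarith
      _ ≤ _ := by gcongr

end GeometricSum

section Integrals

lemma setLIntegral_Ico_eq_sub {F f : ℝ → ℝ} (hF : ∀ y, HasDerivAt F (f y) y)
    (hf : Continuous f) {a b : ℝ} (hab : a ≤ b) (hf₀ : ∀ y ∈ Set.Ico a b, 0 ≤ f y) :
    ∫⁻ y in Set.Ico a b, ENNReal.ofReal (f y) = ENNReal.ofReal (F b - F a) := by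
  rw [← intervalIntegral.integral_eq_sub_of_hasDerivAt (fun y _ => hF y)
    (hf.intervalIntegrable _ _), intervalIntegral.integral_of_le hab,
    setIntegral_congr_set (Ico_ae_eq_Ioc (μ := volume)).symm,
    ofReal_integral_eq_lintegral_ofReal]
  · exact hf.integrableOn_Icc.mono_set Set.Ico_subset_Icc_self
  · exact (ae_restrict_iff' measurableSet_Ico).2 (ae_of_all _ hf₀)

variable {p x : ℝ}

lemma hasDerivAt_one_sub_mul_pow (p : ℝ) (b : ℕ) (y : ℝ) :
    HasDerivAt (fun y : ℝ => (1 - p * y) ^ b) (-(b * p * (1 - p * y) ^ (b - 1))) y := by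
  refine ((((hasDerivAt_id y).const_mul p).const_sub 1).pow b).congr_deriv ?_
  simp only [id_eq, mul_one]
  ring

lemma one_sub_mul_nonneg (hp₀ : 0 ≤ p) (hp₁ : p ≤ 1) (hx : x ≤ 1) : 0 ≤ 1 - p * x := by
  nlinarith

lemma one_sub_mul_pow_mem_Icc (hp₀ : 0 ≤ p) (hp₁ : p ≤ 1) (hx : x ∈ Set.Icc (0 : ℝ) 1) (b : ℕ) :
    (1 - p * x) ^ b ∈ Set.Icc (0 : ℝ) 1 := by
  have := one_sub_mul_nonneg hp₀ hp₁ hx.2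
  exact ⟨by positivity, pow_le_one₀ this (by nlinarith [hx.1])⟩

lemma setLIntegral_deriv_pow (hp₀ : 0 ≤ p) (hp₁ : p ≤ 1) (b : ℕ) (hx : x ∈ Set.Icc (0 : ℝ) 1) :
    ∫⁻ y in Set.Ico 0 x, ENNReal.ofReal (b * p * (1 - p * y) ^ (b - 1)) =
      ENNReal.ofReal (1 - (1 - p * x) ^ b) := by
  have hderiv (y : ℝ) :
      HasDerivAt (fun y : ℝ => 1 - (1 - p * y) ^ b) (b * p * (1 - p * y) ^ (b - 1)) y := by
    simpa using (hasDerivAt_one_sub_mul_pow p b y).const_sub 1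
  rw [setLIntegral_Ico_eq_sub hderiv (by fun_prop) hx.1]
  · simp
  · intro y hy
    have := one_sub_mul_nonneg hp₀ hp₁ (hy.2.le.trans hx.2)
    positivity

lemma setLIntegral_geomSum_mul_expSum (hp₀ : 0 ≤ p) (hp₁ : p ≤ 1) (b R : ℕ)
    (hx : x ∈ Set.Icc (0 : ℝ) 1) :
    ∫⁻ y in Set.Ico 0 x, ENNReal.ofReal (b * p * (1 - p * y) ^ (b - 1)) *
      ENNReal.ofReal (geomSum R ((1 - p * y) ^ b) * expSum R ((1 - p * y) ^ b)) =
      ENNReal.ofReal (expSum R ((1 - p * x) ^ b) - 1) := by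
  have hderiv (y : ℝ) : HasDerivAt (fun y : ℝ => expSum R ((1 - p * y) ^ b))
      (b * p * (1 - p * y) ^ (b - 1) *
        (geomSum R ((1 - p * y) ^ b) * expSum R ((1 - p * y) ^ b))) y :=
    ((hasDerivAt_expSum R _).comp y (hasDerivAt_one_sub_mul_pow p b y)).congr_deriv (by ring)
  have hnonneg : ∀ y ∈ Set.Ico 0 x, 0 ≤ 1 - p * y := fun y hy =>
    one_sub_mul_nonneg hp₀ hp₁ (hy.2.le.trans hx.2)
  have hpos : ∀ y ∈ Set.Ico 0 x, 0 ≤ b * p * (1 - p * y) ^ (b - 1) := fun y hy => by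
    have := hnonneg y hy
    positivity
  rw [setLIntegral_congr_fun measurableSet_Ico fun y hy => (ENNReal.ofReal_mul (hpos y hy)).symm,
    setLIntegral_Ico_eq_sub hderiv _ hx.1]
  · simp [expSum_one]
  · exact fun y hy => mul_nonneg (hpos y hy)
      (mul_nonneg (geomSum_nonneg _ (pow_nonneg (hnonneg y hy) _)) (Real.exp_nonneg _))
  · have := (differentiable_geomSum R).continuous
    fun_prop

end Integrals

section Binomial

variable {ι : Type*}

lemma sum_powerset_binomial (S : Finset ι) (p z : ℝ) :
    ∑ A ∈ S.powerset, p ^ A.card * (1 - p) ^ (S.card - A.card) * z ^ A.card =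
      (p * z + (1 - p)) ^ S.card := by
  rw [← Finset.sum_pow_mul_eq_add_pow]
  refine Finset.sum_congr rfl fun A _ => ?_
  rw [mul_pow]
  ring

lemma sum_powerset_binomial_deriv (S : Finset ι) (p z : ℝ) :
    ∑ A ∈ S.powerset, p ^ A.card * (1 - p) ^ (S.card - A.card) * (A.card * z ^ (A.card - 1)) =
      S.card * p * (p * z + (1 - p)) ^ (S.card - 1) := by
  have hpow : HasDerivAt (fun z : ℝ => (p * z + (1 - p)) ^ S.card)
      (S.card * p * (p * z + (1 - p)) ^ (S.card - 1)) z := by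
    refine ((((hasDerivAt_id z).const_mul p).add_const (1 - p)).pow S.card).congr_deriv ?_
    simp only [id_eq, mul_one]
    ring
  have hsum : HasDerivAt (fun z : ℝ => (p * z + (1 - p)) ^ S.card)
      (∑ A ∈ S.powerset, p ^ A.card * (1 - p) ^ (S.card - A.card) *
        (A.card * z ^ (A.card - 1))) z := by
    simp only [← sum_powerset_binomial]
    exact HasDerivAt.fun_sum fun A _ => (hasDerivAt_pow _ z).const_mul _
  exact hsum.unique hpow

variable (S : Finset ι) {p x : ℝ}

lemma sum_subsetWeight_mul_pow (hp₀ : 0 ≤ p) (hp₁ : p ≤ 1) (hx : x ≤ 1) :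
    ∑ A ∈ S.powerset, subsetWeight p S A * ENNReal.ofReal (1 - x) ^ A.card =
      ENNReal.ofReal ((1 - p * x) ^ S.card) := by
  have : 0 ≤ 1 - p := sub_nonneg.2 hp₁
  have hz : 0 ≤ 1 - x := sub_nonneg.2 hx
  have hbase : 1 - p * x = p * (1 - x) + (1 - p) := by ring
  rw [hbase, ← sum_powerset_binomial, ENNReal.ofReal_sum_of_nonneg fun A _ => by positivity]
  refine Finset.sum_congr rfl fun A _ => ?_
  rw [subsetWeight, ENNReal.ofReal_mul (p := _ * _) (by positivity), ENNReal.ofReal_pow hz]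

lemma sum_subsetWeight_mul_card_mul_pow (hp₀ : 0 ≤ p) (hp₁ : p ≤ 1) (hx : x ≤ 1) :
    ∑ A ∈ S.powerset, subsetWeight p S A * (A.card * ENNReal.ofReal (1 - x) ^ (A.card - 1)) =
      ENNReal.ofReal (S.card * p * (1 - p * x) ^ (S.card - 1)) := by
  have : 0 ≤ 1 - p := sub_nonneg.2 hp₁
  have hz : 0 ≤ 1 - x := sub_nonneg.2 hx
  have hbase : 1 - p * x = p * (1 - x) + (1 - p) := by ring
  rw [hbase, ← sum_powerset_binomial_deriv, ENNReal.ofReal_sum_of_nonneg fun A _ => by positivity]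
  refine Finset.sum_congr rfl fun A _ => ?_
  rw [subsetWeight, ENNReal.ofReal_mul (p := _ * _) (by positivity),
    ENNReal.ofReal_mul (p := (A.card : ℝ)) (by positivity), ENNReal.ofReal_pow hz,
    ENNReal.ofReal_natCast]

lemma sum_subsetWeight (hp₀ : 0 ≤ p) (hp₁ : p ≤ 1) :
    ∑ A ∈ S.powerset, subsetWeight p S A = 1 := by
  simpa using sum_subsetWeight_mul_pow S hp₀ hp₁ zero_le_one

lemma sum_subsetWeight_mul_card (hp₀ : 0 ≤ p) (hp₁ : p ≤ 1) :
    ∑ A ∈ S.powerset, subsetWeight p S A * A.card = ENNReal.ofReal p * S.card := by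
  rw [mul_comm, ← ENNReal.ofReal_natCast S.card, ← ENNReal.ofReal_mul (by positivity)]
  simpa using sum_subsetWeight_mul_card_mul_pow S hp₀ hp₁ zero_le_one

lemma sum_subsetWeight_mul_stay_add_jump (hp₀ : 0 ≤ p) (hp₁ : p ≤ 1) (hx : x ≤ 1) (c : ℝ≥0∞)
    {f : ℝ → ℝ≥0∞} (hf : Measurable f) :
    ∑ A ∈ S.powerset, subsetWeight p S A * (ENNReal.ofReal (1 - x) ^ A.card * c +
        ∑ _w ∈ A, ∫⁻ y in Set.Ico 0 x, ENNReal.ofReal (1 - y) ^ (A.card - 1) * f y) =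
      ENNReal.ofReal ((1 - p * x) ^ S.card) * c +
        ∫⁻ y in Set.Ico 0 x, ENNReal.ofReal (S.card * p * (1 - p * y) ^ (S.card - 1)) * f y := by
  have hjump (A : Finset ι) : subsetWeight p S A *
        ∑ _w ∈ A, ∫⁻ y in Set.Ico 0 x, ENNReal.ofReal (1 - y) ^ (A.card - 1) * f y =
      ∫⁻ y in Set.Ico 0 x,
        subsetWeight p S A * (A.card * ENNReal.ofReal (1 - y) ^ (A.card - 1)) * f y := by
    rw [Finset.sum_const, nsmul_eq_mul, ← lintegral_const_mul _ (by fun_prop),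
      ← lintegral_const_mul _ (by fun_prop)]
    simp only [mul_assoc]
  simp only [mul_add, Finset.sum_add_distrib, hjump]
  rw [← lintegral_finsetSum _ fun A _ => by fun_prop]
  congr 1
  · simp only [← mul_assoc, ← Finset.sum_mul, sum_subsetWeight_mul_pow S hp₀ hp₁ hx]
  · refine setLIntegral_congr_fun measurableSet_Ico fun y hy => ?_
    rw [← Finset.sum_mul, sum_subsetWeight_mul_card_mul_pow S hp₀ hp₁ (hy.2.le.trans hx)]

end Binomial

section OneStepBounds

variable (ρ τ : ℕ → ℝ≥0∞) (B : ℕ) (p : I) (N : ℕ) {s : State n} {x : ℝ} {c : ℝ≥0∞}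
  {f : ℝ → ℝ≥0∞}

lemma meanReward_succ_le (hs : s.Valid) (hx : x ∈ Set.Icc (0 : ℝ) 1) (hf : Measurable f)
    (hstay : ∀ A ⊆ s.block B, meanReward ρ τ B p N (s.stay B A) x ≤ c)
    (hjump : ∀ A ⊆ s.block B, ∀ w ∈ A, ∀ y ∈ Set.Ico 0 x,
      meanReward ρ τ B p N (s.jump A w) y ≤ f y) :
    meanReward ρ τ B p (N + 1) s x ≤ ρ s.pending.card +
      (ENNReal.ofReal ((1 - p * x) ^ (s.block B).card) * c + ∫⁻ y in Set.Ico 0 x,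
        ENNReal.ofReal ((s.block B).card * p * (1 - p * y) ^ ((s.block B).card - 1)) * f y) := by
  rw [meanReward_succ ρ τ B p N hs hx,
    ← sum_subsetWeight_mul_stay_add_jump (s.block B) p.2.1 p.2.2 hx.2 c hf]
  refine add_le_add le_rfl (Finset.sum_le_sum fun A hA => mul_le_mul' le_rfl
    (add_le_add (mul_le_mul' le_rfl ?_) (Finset.sum_le_sum fun w hw => ?_)))
  · exact hstay A (Finset.mem_powerset.1 hA)
  · refine setLIntegral_mono (by fun_prop) fun y hy => ?_
    gcongr
    exact hjump A (Finset.mem_powerset.1 hA) w hw y hy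

lemma le_meanReward_succ (hs : s.Valid) (hx : x ∈ Set.Icc (0 : ℝ) 1) (hf : Measurable f)
    (hstay : ∀ A ⊆ s.block B, c ≤ meanReward ρ τ B p N (s.stay B A) x)
    (hjump : ∀ A ⊆ s.block B, ∀ w ∈ A, ∀ y ∈ Set.Ico 0 x,
      f y ≤ meanReward ρ τ B p N (s.jump A w) y) :
    ρ s.pending.card +
      (ENNReal.ofReal ((1 - p * x) ^ (s.block B).card) * c + ∫⁻ y in Set.Ico 0 x,
        ENNReal.ofReal ((s.block B).card * p * (1 - p * y) ^ ((s.block B).card - 1)) * f y) ≤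
      meanReward ρ τ B p (N + 1) s x := by
  rw [meanReward_succ ρ τ B p N hs hx,
    ← sum_subsetWeight_mul_stay_add_jump (s.block B) p.2.1 p.2.2 hx.2 c hf]
  refine add_le_add le_rfl (Finset.sum_le_sum fun A hA => mul_le_mul' le_rfl
    (add_le_add (mul_le_mul' le_rfl ?_) (Finset.sum_le_sum fun w hw => ?_)))
  · exact hstay A (Finset.mem_powerset.1 hA)
  · have := measurable_meanReward ρ τ B p N (s.jump A w)
    refine setLIntegral_mono (by fun_prop) fun y hy => ?_
    gcongr
    exact hjump A (Finset.mem_powerset.1 hA) w hw y hy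

end OneStepBounds

section Steps

variable {B R : ℕ} {p : I} {x : ℝ}

/-- The candidate `geomSum r a * expSum R a`, where `a = (1 - p * x) ^ B` is the probability that a
block holds no neighbour of cost below `x`, for the mean number of steps from a vertex of cost `x`
with `r` blocks pending, if `R` blocks are to be examined from each later vertex. -/
def blockSteps (B R : ℕ) (p x : ℝ) (r : ℕ) : ℝ :=
  geomSum r ((1 - p * x) ^ B) * expSum R ((1 - p * x) ^ B)

@[fun_prop]
lemma measurable_blockSteps (B R : ℕ) (p : ℝ) (r : ℕ) : Measurable (blockSteps B R p · r) := by
  have := (differentiable_geomSum r).continuous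
  unfold blockSteps
  fun_prop

lemma blockSteps_nonneg (hx : x ≤ 1) (r : ℕ) : 0 ≤ blockSteps B R p x r :=
  mul_nonneg (geomSum_nonneg _ (pow_nonneg (one_sub_mul_nonneg p.2.1 p.2.2 hx) _))
    (Real.exp_nonneg _)

lemma blockSteps_zero (B R : ℕ) (p x : ℝ) : blockSteps B R p x 0 = 0 := by
  simp [blockSteps, geomSum]

lemma blockSteps_mono (hx : x ≤ 1) {r r' : ℕ} (h : r ≤ r') :
    blockSteps B R p x r ≤ blockSteps B R p x r' :=
  mul_le_mul_of_nonneg_right (geomSum_mono h (pow_nonneg (one_sub_mul_nonneg p.2.1 p.2.2 hx) _))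
    (Real.exp_nonneg _)

lemma blockSteps_self_le (hx : x ≤ 1) : blockSteps B R p x R ≤ expHarmonic R :=
  geomSum_mul_expSum_le R (pow_nonneg (one_sub_mul_nonneg p.2.1 p.2.2 hx) _)

lemma blockSteps_succ (hx : x ∈ Set.Icc (0 : ℝ) 1) (r : ℕ) :
    ENNReal.ofReal (blockSteps B R p x (r + 1)) =
      1 + (ENNReal.ofReal ((1 - p * x) ^ B) * ENNReal.ofReal (blockSteps B R p x r) +
        ∫⁻ y in Set.Ico 0 x, ENNReal.ofReal (B * p * (1 - p * y) ^ (B - 1)) *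
          ENNReal.ofReal (blockSteps B R p y R)) := by
  obtain ⟨ha₀, ha₁⟩ := one_sub_mul_pow_mem_Icc p.2.1 p.2.2 hx B
  have hexp := one_le_expSum R ha₀ ha₁
  have hsteps := mul_nonneg ha₀ (blockSteps_nonneg (B := B) (R := R) (p := p) hx.2 r)
  simp only [blockSteps] at hsteps ⊢
  rw [setLIntegral_geomSum_mul_expSum p.2.1 p.2.2 B R hx, ← ENNReal.ofReal_mul ha₀,
    ← ENNReal.ofReal_add hsteps (sub_nonneg.2 hexp), ← ENNReal.ofReal_one,
    ← ENNReal.ofReal_add zero_le_one (by linarith), geomSum_succ]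
  ring_nf

lemma one_add_lintegral_le_blockSteps (hM : 3 ≤ (1 - (p : ℝ)) ^ B * expHarmonic R) {q : ℕ}
    (hq : q ≤ B) (hx : x ∈ Set.Icc (0 : ℝ) 1) :
    1 + ∫⁻ y in Set.Ico 0 x, ENNReal.ofReal (q * p * (1 - p * y) ^ (q - 1)) *
      ENNReal.ofReal (blockSteps B R p y R) ≤ ENNReal.ofReal (blockSteps B R p x 3) := by
  obtain ⟨hp₀, hp₁⟩ := p.2
  obtain ⟨ha₀, ha₁⟩ := one_sub_mul_pow_mem_Icc hp₀ hp₁ hx B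
  obtain ⟨-, hb₁⟩ := one_sub_mul_pow_mem_Icc hp₀ hp₁ hx q
  have hab : (1 - p * x) ^ B ≤ (1 - p * x) ^ q :=
    pow_le_pow_of_le_one (one_sub_mul_nonneg hp₀ hp₁ hx.2) (by nlinarith [hx.1]) hq
  have haM : 3 ≤ (1 - p * x) ^ B * expHarmonic R := by
    refine hM.trans (mul_le_mul_of_nonneg_right ?_ (expHarmonic_pos R).le)
    exact pow_le_pow_left₀ (sub_nonneg.2 hp₁) (by nlinarith [hx.2]) B
  have hint : ∫⁻ y in Set.Ico 0 x, ENNReal.ofReal (q * p * (1 - p * y) ^ (q - 1)) *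
      ENNReal.ofReal (blockSteps B R p y R) ≤
        ENNReal.ofReal ((1 - (1 - p * x) ^ q) * expHarmonic R) := by
    rw [ENNReal.ofReal_mul (sub_nonneg.2 hb₁), ← setLIntegral_deriv_pow hp₀ hp₁ q hx,
      ← lintegral_mul_const _ (by fun_prop)]
    refine setLIntegral_mono (by fun_prop) fun y hy => ?_
    gcongr
    exact blockSteps_self_le (hy.2.le.trans hx.2)
  calc _ ≤ 1 + ENNReal.ofReal ((1 - (1 - p * x) ^ q) * expHarmonic R) := by gcongr
    _ = ENNReal.ofReal (1 + (1 - (1 - p * x) ^ q) * expHarmonic R) := by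
      rw [ENNReal.ofReal_add zero_le_one
        (mul_nonneg (sub_nonneg.2 hb₁) (expHarmonic_pos R).le), ENNReal.ofReal_one]
    _ ≤ _ := ENNReal.ofReal_le_ofReal (one_add_le_geomSum_mul_expSum R ha₀ ha₁ hab haM)

/-- A number of full blocks that costs at least as much to examine as `q` pending vertices:
`⌈q / B⌉` blocks, and two more to make up for the last block not being full. -/
def paddedBlocks (B q : ℕ) : ℕ := if q = 0 then 0 else (q + B - 1) / B + 2

lemma paddedBlocks_of_le {q : ℕ} (hq₀ : 0 < q) (hq : q ≤ B) : paddedBlocks B q = 3 := by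
  have : (q + B - 1) / B = 1 := by
    rw [Nat.div_eq_iff (by omega)]
    omega
  rw [paddedBlocks, if_neg hq₀.ne', this]

lemma paddedBlocks_of_lt (hB : 1 ≤ B) {q : ℕ} (hq : B < q) :
    paddedBlocks B q = paddedBlocks B (q - B) + 1 := by
  have : (q + B - 1) / B = (q - B + B - 1) / B + 1 := by
    rw [← Nat.add_div_right _ (by omega)]
    congr 1
    omega
  rw [paddedBlocks, paddedBlocks, if_neg (by omega), if_neg (by omega), this]

lemma paddedBlocks_mono (B : ℕ) : Monotone (paddedBlocks B) := by
  intro q q' h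
  unfold paddedBlocks
  split_ifs
  · exact le_rfl
  · exact Nat.zero_le _
  · omega
  · gcongr

lemma le_blockSteps_paddedBlocks (hB : 1 ≤ B) (hM : 3 ≤ (1 - (p : ℝ)) ^ B * expHarmonic R)
    (hx : x ∈ Set.Icc (0 : ℝ) 1) (q : ℕ) :
    stepCount q + (ENNReal.ofReal ((1 - p * x) ^ min q B) *
        ENNReal.ofReal (blockSteps B R p x (paddedBlocks B (q - B))) +
      ∫⁻ y in Set.Ico 0 x, ENNReal.ofReal ((min q B : ℕ) * p * (1 - p * y) ^ (min q B - 1)) *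
        ENNReal.ofReal (blockSteps B R p y R)) ≤
      ENNReal.ofReal (blockSteps B R p x (paddedBlocks B q)) := by
  rcases Nat.eq_zero_or_pos q with rfl | hq₀
  · simp [stepCount, paddedBlocks, blockSteps_zero]
  rw [stepCount, if_pos hq₀]
  rcases le_or_gt q B with hq | hq
  · rw [paddedBlocks_of_le hq₀ hq, min_eq_left hq, Nat.sub_eq_zero_of_le hq, paddedBlocks,
      if_pos rfl, blockSteps_zero, ENNReal.ofReal_zero, mul_zero, zero_add]
    exact one_add_lintegral_le_blockSteps hM hq hx
  · rw [paddedBlocks_of_lt hB hq, blockSteps_succ hx, min_eq_right hq.le]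

lemma meanReward_stepCount_le (hB : 1 ≤ B) (hR : paddedBlocks B n ≤ R)
    (hM : 3 ≤ (1 - (p : ℝ)) ^ B * expHarmonic R) (N : ℕ) {s : State n} (hs : s.Valid)
    (hx : x ∈ Set.Icc (0 : ℝ) 1) :
    meanReward stepCount (fun _ => 0) B p N s x ≤
      ENNReal.ofReal (blockSteps B R p x (paddedBlocks B s.pending.card)) := by
  induction N generalizing s x with
  | zero => simp [meanReward, meanRewardOfCosts, reward]
  | succ N ih =>
    refine (meanReward_succ_le _ _ B p N hs hx
      (c := ENNReal.ofReal (blockSteps B R p x (paddedBlocks B (s.pending.card - B))))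
      (f := fun y => ENNReal.ofReal (blockSteps B R p y R)) (by fun_prop) ?_ ?_).trans ?_
    · intro A hA
      rw [← s.card_stay_pending B A]
      exact ih (hs.stay hA) hx
    · intro A _ w hw y hy
      have hy₁ : y ≤ 1 := hy.2.le.trans hx.2
      have hcard : (s.jump A w).pending.card ≤ n := (Finset.card_le_univ _).trans (by simp)
      exact (ih (s.valid_jump hw) ⟨hy.1, hy₁⟩).trans <| ENNReal.ofReal_le_ofReal <|
        blockSteps_mono hy₁ ((paddedBlocks_mono B hcard).trans hR)
    · rw [State.card_block]
      exact le_blockSteps_paddedBlocks hB hM hx _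

lemma le_reward_of_antitone (ρ : ℕ → ℝ≥0∞) {τ : ℕ → ℝ≥0∞} (hτ : Antitone τ) (B N : ℕ)
    (s : State n) (G : SimpleGraph (Fin n)) (W : Fin n → ℝ) :
    τ s.unexplored.card ≤ reward ρ τ B N s G W := by
  induction N generalizing s with
  | zero => exact le_rfl
  | succ N ih =>
    refine le_trans (hτ ?_) (le_add_left (ih _))
    rw [s.step_unexplored]
    exact Finset.card_le_card Finset.sdiff_subset

lemma le_meanReward_of_antitone (ρ : ℕ → ℝ≥0∞) {τ : ℕ → ℝ≥0∞} (hτ : Antitone τ) (B : ℕ) (p : I)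
    (N : ℕ) (s : State n) (x : ℝ) : τ s.unexplored.card ≤ meanReward ρ τ B p N s x := by
  have hcosts (W : Fin n → ℝ) : τ s.unexplored.card ≤ meanRewardOfCosts ρ τ B p N s W := by
    calc τ s.unexplored.card
        = ∫⁻ _G, τ s.unexplored.card ∂SimpleGraph.binomialRandom (Fin n) p := by simp
      _ ≤ _ := lintegral_mono fun G => le_reward_of_antitone ρ hτ B N s G W
  calc τ s.unexplored.card = ∫⁻ _W, τ s.unexplored.card ∂costLaw n := by simp
    _ ≤ _ := lintegral_mono fun W => hcosts _

lemma antitone_exploredCount (n : ℕ) : Antitone (exploredCount n) := by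
  intro u u' h
  unfold exploredCount
  gcongr

/-- The running reward that counts the steps in which a full block is examined. -/
def fullStepCount (B q : ℕ) : ℝ≥0∞ := if B ≤ q then 1 else 0

/-- The number of full blocks that the lower bound counts on, with `u` unexplored and `q` pending
vertices. It is capped at `R`, and it is `R` once `u < R * B`: from then on the lower bound is
provided by the number of explored vertices instead. -/
def fullBlocks (B R u q : ℕ) : ℕ := if u < R * B then R else min (q / B) R

lemma fullBlocks_self (hB : 1 ≤ B) (u : ℕ) : fullBlocks B R u u = R := by
  rw [fullBlocks]
  split_ifs with hu
  · rfl
  · exact min_eq_right ((Nat.le_div_iff_mul_le hB).2 (not_lt.1 hu))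

lemma min_div_le_fullBlocks_sub_add_one (hB : 1 ≤ B) (u : ℕ) {q : ℕ} (hq : B ≤ q) :
    min (q / B) R ≤ fullBlocks B R u (q - B) + 1 := by
  have hdiv : q / B = (q - B) / B + 1 := by
    rw [← Nat.add_div_right _ hB, Nat.sub_add_cancel hq]
  rw [fullBlocks]
  split_ifs <;> omega

lemma le_meanReward_of_card_unexplored_lt {K : ℝ≥0∞}
    (hK : ∀ u < R * B, ENNReal.ofReal (expHarmonic R) ≤ K * exploredCount n u) (N : ℕ)
    {s : State n} (hx : x ≤ 1) (hu : s.unexplored.card < R * B) :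
    ENNReal.ofReal (blockSteps B R p x R) ≤
      meanReward (fullStepCount B) (fun u => K * exploredCount n u) B p N s x := by
  have hτ : Antitone fun u => K * exploredCount n u := fun u u' h =>
    mul_le_mul_right (antitone_exploredCount n h) K
  exact (ENNReal.ofReal_le_ofReal (blockSteps_self_le hx)).trans <|
    (hK _ hu).trans <| le_meanReward_of_antitone _ hτ B p N s x

lemma le_meanReward_fullStepCount (hB : 1 ≤ B) {K : ℝ≥0∞}
    (hK : ∀ u < R * B, ENNReal.ofReal (expHarmonic R) ≤ K * exploredCount n u) (N : ℕ)
    {s : State n} (hs : s.Valid) (hN : s.potential ≤ N) (hx : x ∈ Set.Icc (0 : ℝ) 1) :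
    ENNReal.ofReal (blockSteps B R p x (fullBlocks B R s.unexplored.card s.pending.card)) ≤
      meanReward (fullStepCount B) (fun u => K * exploredCount n u) B p N s x := by
  induction N generalizing s x with
  | zero =>
    have hq : s.pending.card = 0 := Nat.eq_zero_of_add_eq_zero_left (Nat.le_zero.1 hN)
    rw [fullBlocks]
    split_ifs with hu
    · exact le_meanReward_of_card_unexplored_lt hK _ hx.2 hu
    · simp [hq, blockSteps_zero]
  | succ N ih =>
    rw [fullBlocks]
    split_ifs with hu
    · exact le_meanReward_of_card_unexplored_lt hK _ hx.2 hu
    rcases Nat.eq_zero_or_pos (min (s.pending.card / B) R) with hzero | hpos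
    · simp [hzero, blockSteps_zero]
    have hq : B ≤ s.pending.card := (Nat.div_pos_iff.1 (lt_min_iff.1 hpos).1).2
    have hne : s.pending.Nonempty := Finset.card_pos.1 (by omega)
    obtain ⟨r, hr⟩ := Nat.exists_eq_succ_of_ne_zero hpos.ne'
    have hstay : ∀ A ⊆ s.block B, ENNReal.ofReal (blockSteps B R p x r) ≤
        meanReward (fullStepCount B) (fun u => K * exploredCount n u) B p N (s.stay B A) x := by
      intro A hA
      have hlt := State.potential_stay_lt hne hB A
      refine le_trans (ENNReal.ofReal_le_ofReal (blockSteps_mono hx.2 ?_))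
        (ih (hs.stay hA) (by omega) hx)
      have := min_div_le_fullBlocks_sub_add_one (R := R) hB (s.stay B A).unexplored.card hq
      rw [State.card_stay_pending]
      omega
    have hjump : ∀ A ⊆ s.block B, ∀ w ∈ A, ∀ y ∈ Set.Ico 0 x,
        ENNReal.ofReal (blockSteps B R p y R) ≤
        meanReward (fullStepCount B) (fun u => K * exploredCount n u) B p N (s.jump A w) y := by
      intro A hA w hw y hy
      have hlt := State.potential_jump_lt (hA.trans (hs.block_subset B)) hw
      refine le_trans (le_of_eq ?_) (ih (s.valid_jump hw) (by omega) ⟨hy.1, hy.2.le.trans hx.2⟩)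
      rw [State.jump, fullBlocks_self hB]
    refine le_trans (le_of_eq ?_)
      (le_meanReward_succ _ _ B p N hs hx (by fun_prop) hstay hjump)
    rw [hr, State.card_block, min_eq_right hq, fullStepCount, if_pos hq, blockSteps_succ hx]

end Steps

section Explored

open Classical in
lemma ite_forall_le_add_sum_ite_isBest (W : Fin n → ℝ) (x : ℝ) (A : Finset (Fin n)) (a b : ℝ≥0∞)
    (c : Fin n → ℝ≥0∞) :
    ((if ∀ u ∈ A, x ≤ W u then a + b else 0) + ∑ w ∈ A, if IsBest W x A w then a + c w else 0) =
      a + ((if ∀ u ∈ A, x ≤ W u then b else 0) + ∑ w ∈ A, if IsBest W x A w then c w else 0) := by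
  rcases forall_le_or_exists_isBest W x A with h | ⟨w, hw, hbest⟩
  · have hnot (w : Fin n) (hw : w ∈ A) : ¬ IsBest W x A w := fun hbest => (h w hw).not_gt hbest.1
    simp +contextual [h, hnot]
  · have hnot : ¬ ∀ u ∈ A, x ≤ W u := fun h => (h w hw).not_gt hbest.1
    have hunique (w' : Fin n) (hw' : w' ∈ A) (hne : w' ≠ w) : ¬ IsBest W x A w' :=
      fun hbest' => hne (hbest'.unique hw' hw hbest)
    rw [if_neg hnot, if_neg hnot, Finset.sum_eq_single_of_mem w hw fun w' hw' hne =>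
      if_neg (hunique w' hw' hne), Finset.sum_eq_single_of_mem w hw fun w' hw' hne =>
      if_neg (hunique w' hw' hne), if_pos hbest, if_pos hbest, zero_add, zero_add]

lemma State.Valid.exploredCount_sdiff {s : State n} (hs : s.Valid) {A : Finset (Fin n)}
    (hA : A ⊆ s.unexplored) :
    exploredCount n (s.unexplored \ A).card = exploredCount n s.unexplored.card + A.card := by
  have hsdiff := Finset.card_sdiff_add_card_eq_card hA
  have hcard : s.unexplored.card + 1 ≤ n := by
    rw [← Finset.card_insert_of_notMem hs.1]
    exact (Finset.card_le_univ _).trans (by simp)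
  rw [exploredCount, exploredCount, ← Nat.cast_add]
  congr 1
  omega

/- Every examined vertex is a neighbour of the current one with probability `p`, so the explored
vertices are in mean a proportion `p` of the examined ones. -/
lemma meanRewardOfCosts_exploredCount (B : ℕ) (p : I) (N : ℕ) {s : State n} (hs : s.Valid)
    (W : Fin n → ℝ) :
    meanRewardOfCosts (fun _ => 0) (exploredCount n) B p N s W =
      exploredCount n s.unexplored.card +
        meanRewardOfCosts (fun q => ENNReal.ofReal p * (min q B : ℕ)) (fun _ => 0) B p N s W := by
  induction N generalizing s with
  | zero => simp [meanRewardOfCosts, reward]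
  | succ N ih =>
    rw [meanRewardOfCosts_succ _ _ B p N hs, meanRewardOfCosts_succ _ _ B p N hs, zero_add,
      ← s.card_block B, ← sum_subsetWeight_mul_card _ p.2.1 p.2.2, ← add_assoc,
      ← one_mul (exploredCount n _), ← sum_subsetWeight (s.block B) p.2.1 p.2.2, Finset.sum_mul,
      ← Finset.sum_add_distrib, ← Finset.sum_add_distrib]
    refine Finset.sum_congr rfl fun A hA => ?_
    rw [Finset.mem_powerset] at hA
    have hcount := hs.exploredCount_sdiff (hA.trans (hs.block_subset B))
    have hstay := ih (hs.stay hA)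
    have hjump (w : Fin n) (hw : w ∈ A) := ih (s.valid_jump hw)
    simp only [State.stay, State.jump, hcount] at hstay hjump ⊢
    rw [hstay, Finset.sum_congr rfl fun w hw => by rw [hjump w hw],
      ite_forall_le_add_sum_ite_isBest]
    ring

end Explored

section ExpectedReward

/-- The law of the model for an arbitrary connection probability `p`. -/
def sampleLaw (p : I) (n : ℕ) : Measure (Sample n) :=
  (SimpleGraph.binomialRandom (Fin n) p).prod
    ((costLaw n).prod (uniformOn (Set.univ : Set (Fin n))))

instance [NeZero n] : IsProbabilityMeasure (uniformOn (Set.univ : Set (Fin n))) :=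
  isProbabilityMeasure_uniformOn Set.finite_univ Set.univ_nonempty

instance (p : I) [NeZero n] : IsProbabilityMeasure (sampleLaw p n) := by
  unfold sampleLaw
  infer_instance

/-- The mean reward of a whole run. The `(n + 1) ^ 2` steps are enough for the run to have come to
its end. -/
def expectedReward (ρ τ : ℕ → ℝ≥0∞) (B : ℕ) (p : I) (n : ℕ) : ℝ≥0∞ :=
  ∫⁻ ω, reward ρ τ B ((n + 1) ^ 2) (State.init ω.2.2) ω.1 ω.2.1 ∂sampleLaw p n

variable (ρ τ : ℕ → ℝ≥0∞) (B : ℕ) (p : I)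

lemma measurable_reward_init (N : ℕ) :
    Measurable fun ω : Sample n => reward ρ τ B N (State.init ω.2.2) ω.1 ω.2.1 :=
  measurable_from_prod_countable_right fun G =>
    measurable_from_prod_countable_left fun v => measurable_reward_right ρ τ B N (State.init v) G

lemma expectedReward_eq_lintegral_meanRewardOfCosts :
    expectedReward ρ τ B p n = ∫⁻ v, ∫⁻ W,
      meanRewardOfCosts ρ τ B p ((n + 1) ^ 2) (State.init v) W ∂costLaw n
        ∂uniformOn (Set.univ : Set (Fin n)) := by
  have hmeas := measurable_reward_init (n := n) ρ τ B ((n + 1) ^ 2)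
  rw [expectedReward, sampleLaw, lintegral_prod_symm' _ hmeas,
    lintegral_prod_symm' _ hmeas.lintegral_prod_left']
  rfl

lemma lintegral_meanRewardOfCosts (N : ℕ) (s : State n) :
    ∫⁻ W, meanRewardOfCosts ρ τ B p N s W ∂costLaw n = ∫⁻ x, meanReward ρ τ B p N s x ∂unif := by
  have hmeas := measurable_meanRewardOfCosts ρ τ B p N s
  have hupdate : Measurable (Function.uncurry fun (W : Fin n → ℝ) (y : ℝ) =>
      meanRewardOfCosts ρ τ B p N s (Function.update W s.cur y)) := hmeas.comp measurable_update'
  rw [lintegral_pi_eq_lintegral_update _ hmeas s.cur,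
    lintegral_lintegral_swap hupdate.aemeasurable]
  rfl

lemma expectedReward_eq_lintegral_meanReward :
    expectedReward ρ τ B p n = ∫⁻ v, ∫⁻ x,
      meanReward ρ τ B p ((n + 1) ^ 2) (State.init v) x ∂unif
        ∂uniformOn (Set.univ : Set (Fin n)) := by
  simp only [expectedReward_eq_lintegral_meanRewardOfCosts, lintegral_meanRewardOfCosts]

lemma expectedReward_const_mul (c : ℝ≥0∞) :
    expectedReward (fun q => c * ρ q) (fun u => c * τ u) B p n =
      c * expectedReward ρ τ B p n := by
  rw [expectedReward, expectedReward, ← lintegral_const_mul _ (measurable_reward_init ρ τ B _)]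
  simp only [reward_eq_sum, ← Finset.mul_sum, mul_add]

lemma expectedReward_eq_add : expectedReward ρ τ B p n =
    expectedReward ρ (fun _ => 0) B p n + expectedReward (fun _ => 0) τ B p n := by
  simp only [expectedReward]
  rw [← lintegral_add_left (measurable_reward_init ρ _ B _)]
  simp only [reward_eq_sum, add_zero, Finset.sum_const_zero, zero_add]

variable {ρ} in
lemma expectedReward_mono {ρ' : ℕ → ℝ≥0∞} (h : ∀ q, ρ q ≤ ρ' q) :
    expectedReward ρ τ B p n ≤ expectedReward ρ' τ B p n := by
  refine lintegral_mono fun ω => ?_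
  simp only [reward_eq_sum]
  gcongr
  exact h _

lemma expectedReward_exploredCount (n : ℕ) :
    expectedReward (fun _ => 0) (exploredCount n) B p n =
      expectedReward (fun q => ENNReal.ofReal p * (min q B : ℕ)) (fun _ => 0) B p n := by
  have hinit (v : Fin n) : exploredCount n (State.init v).unexplored.card = 0 := by
    simp [exploredCount, State.card_init_unexplored]
  simp only [expectedReward_eq_lintegral_meanRewardOfCosts,
    meanRewardOfCosts_exploredCount B p _ (State.valid_init _), hinit, zero_add]

lemma expectedReward_exploredCount_le (n : ℕ) :
    expectedReward (fun _ => 0) (exploredCount n) B p n ≤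
      ENNReal.ofReal p * B * expectedReward stepCount (fun _ => 0) B p n := by
  rw [expectedReward_exploredCount, ← expectedReward_const_mul]
  simp only [mul_zero]
  refine expectedReward_mono _ B p fun q => ?_
  rcases Nat.eq_zero_or_pos q with rfl | hq
  · simp
  · rw [stepCount, if_pos hq, mul_one]
    gcongr
    exact min_le_right _ _

lemma mul_expectedReward_fullStepCount_le (n : ℕ) :
    ENNReal.ofReal p * B * expectedReward (fullStepCount B) (fun _ => 0) B p n ≤
      expectedReward (fun _ => 0) (exploredCount n) B p n := by
  rw [expectedReward_exploredCount, ← expectedReward_const_mul]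
  simp only [mul_zero]
  refine expectedReward_mono _ B p fun q => ?_
  rw [fullStepCount]
  split_ifs with hq
  · rw [mul_one, min_eq_right hq]
  · simp

variable {B : ℕ} {p : I}

lemma expectedReward_stepCount_le [NeZero n] {R : ℕ} (hB : 1 ≤ B) (hR : paddedBlocks B n ≤ R)
    (hM : 3 ≤ (1 - (p : ℝ)) ^ B * expHarmonic R) :
    expectedReward stepCount (fun _ => 0) B p n ≤ ENNReal.ofReal (expHarmonic R) := by
  rw [expectedReward_eq_lintegral_meanReward]
  calc _ ≤ ∫⁻ _v : Fin n, ∫⁻ _x, ENNReal.ofReal (expHarmonic R) ∂unif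
        ∂uniformOn (Set.univ : Set (Fin n)) := by
        refine lintegral_mono fun v => setLIntegral_mono measurable_const fun x hx => ?_
        have hcard : (State.init v).pending.card ≤ n := (Finset.card_le_univ _).trans (by simp)
        refine (meanReward_stepCount_le hB hR hM _ (State.valid_init v) hx).trans
          (ENNReal.ofReal_le_ofReal ?_)
        exact (blockSteps_mono hx.2 ((paddedBlocks_mono B hcard).trans hR)).trans
          (blockSteps_self_le hx.2)
    _ = _ := by simp

end ExpectedReward

section LowerBound

variable {B R : ℕ} {p : I}

lemma lintegral_one_sub_mul_pow_le {p : ℝ} (hp₀ : 0 < p) (hp₁ : p ≤ 1) (b : ℕ) :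
    ∫⁻ x, ENNReal.ofReal ((1 - p * x) ^ b) ∂unif ≤ ENNReal.ofReal (1 / (p * (b + 1))) := by
  have hpos : 0 < p * ((b : ℝ) + 1) := by positivity
  have hunif : ∫⁻ x, ENNReal.ofReal ((1 - p * x) ^ b) ∂unif =
      ∫⁻ x in Set.Ico 0 1, ENNReal.ofReal ((1 - p * x) ^ b) := setLIntegral_congr Ico_ae_eq_Icc.symm
  rw [hunif, one_div, ENNReal.ofReal_inv_of_pos hpos, ENNReal.le_inv_iff_mul_le, mul_comm,
    ← lintegral_const_mul _ (by fun_prop)]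
  calc _ = ∫⁻ y in Set.Ico (0 : ℝ) 1,
        ENNReal.ofReal ((b + 1 : ℕ) * p * (1 - p * y) ^ (b + 1 - 1)) := by
        refine lintegral_congr fun y => ?_
        rw [← ENNReal.ofReal_mul hpos.le, Nat.add_sub_cancel, Nat.cast_succ, mul_comm p]
    _ = ENNReal.ofReal (1 - (1 - p * 1) ^ (b + 1)) :=
        setLIntegral_deriv_pow hp₀.le hp₁ (b + 1) ⟨zero_le_one, le_rfl⟩
    _ ≤ 1 := ENNReal.ofReal_le_one.2 (sub_le_self _ (pow_nonneg (by linarith) _))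

lemma expHarmonic_le_blockSteps_add {x : ℝ} (hx : x ∈ Set.Icc (0 : ℝ) 1) :
    expHarmonic R ≤ blockSteps B R p x R + expHarmonic R * (1 - p * x) ^ (B * R) := by
  have ha := one_sub_mul_pow_mem_Icc p.2.1 p.2.2 hx B
  have hle := one_sub_mul_expHarmonic_le_expSum R ha.1 ha.2
  rw [blockSteps, pow_mul]
  set a := (1 - (p : ℝ) * x) ^ B
  have hgeom : geomSum R a * (1 - a) = 1 - a ^ R := geom_sum_mul_neg a R
  calc expHarmonic R
      = geomSum R a * ((1 - a) * expHarmonic R) + expHarmonic R * a ^ R := by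
        rw [← mul_assoc, hgeom]
        ring
    _ ≤ _ := by gcongr; exact geomSum_nonneg R ha.1

lemma expHarmonic_le_lintegral_blockSteps (B R : ℕ) (hp : 0 < p) :
    ENNReal.ofReal (expHarmonic R) ≤
      ∫⁻ x, ENNReal.ofReal (blockSteps B R p x R) ∂unif +
        ENNReal.ofReal (expHarmonic R / (p * (B * R + 1))) := by
  have hM := (expHarmonic_pos R).le
  calc ENNReal.ofReal (expHarmonic R) = ∫⁻ _x, ENNReal.ofReal (expHarmonic R) ∂unif := by simp
    _ ≤ ∫⁻ x, (ENNReal.ofReal (blockSteps B R p x R) +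
          ENNReal.ofReal (expHarmonic R) * ENNReal.ofReal ((1 - p * x) ^ (B * R))) ∂unif := by
        refine setLIntegral_mono ?_ fun x hx => ?_
        · exact (measurable_blockSteps B R p R).ennreal_ofReal.add (by fun_prop)
        · rw [← ENNReal.ofReal_mul hM, ← ENNReal.ofReal_add (blockSteps_nonneg hx.2 R)
            (mul_nonneg hM (one_sub_mul_pow_mem_Icc p.2.1 p.2.2 hx _).1)]
          exact ENNReal.ofReal_le_ofReal (expHarmonic_le_blockSteps_add hx)
    _ ≤ ∫⁻ x, ENNReal.ofReal (blockSteps B R p x R) ∂unif +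
          ENNReal.ofReal (expHarmonic R) * ENNReal.ofReal (1 / (p * ((B * R : ℕ) + 1))) := by
        rw [lintegral_add_left (measurable_blockSteps B R p R).ennreal_ofReal,
          lintegral_const_mul _ (by fun_prop)]
        gcongr
        exact lintegral_one_sub_mul_pow_le hp p.2.2 _
    _ = _ := by rw [← ENNReal.ofReal_mul hM, mul_one_div, Nat.cast_mul]

lemma expHarmonic_le_div_mul_exploredCount (hR : R * B < n) {u : ℕ} (hu : u < R * B) :
    ENNReal.ofReal (expHarmonic R) ≤
      ENNReal.ofReal (expHarmonic R / (n - R * B)) * exploredCount n u := by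
  have hM := expHarmonic_pos R
  have hpos : (0 : ℝ) < n - R * B := sub_pos.2 (by exact_mod_cast hR)
  have hle : (n : ℝ) ≤ (n - 1 - u : ℕ) + R * B := by
    have : n ≤ n - 1 - u + R * B := by omega
    exact_mod_cast this
  rw [exploredCount, ← ENNReal.ofReal_natCast, ← ENNReal.ofReal_mul (by positivity)]
  refine ENNReal.ofReal_le_ofReal ?_
  rw [div_mul_eq_mul_div, le_div_iff₀ hpos]
  gcongr
  linarith

/- The bound on the steps of full blocks fails only if some vertex is reached with fewer than
`R * B` unexplored vertices, that is with at least `n - R * B` explored ones: by Markov's inequality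
this costs the second term. The third one is the mean cost of having `v₁` examine everything. -/
lemma expHarmonic_le_expectedReward [NeZero n] (hB : 1 ≤ B) (hp : 0 < p) (hR : R * B < n) :
    ENNReal.ofReal (expHarmonic R) ≤
      expectedReward (fullStepCount B) (fun _ => 0) B p n +
        ENNReal.ofReal (expHarmonic R / (n - R * B)) *
          expectedReward (fun _ => 0) (exploredCount n) B p n +
        ENNReal.ofReal (expHarmonic R / (p * (B * R + 1))) := by
  set K := ENNReal.ofReal (expHarmonic R / (n - R * B))
  have hsplit : expectedReward (fullStepCount B) (fun u => K * exploredCount n u) B p n =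
      expectedReward (fullStepCount B) (fun _ => 0) B p n +
        K * expectedReward (fun _ => 0) (exploredCount n) B p n := by
    rw [expectedReward_eq_add, ← expectedReward_const_mul]
    simp only [mul_zero]
  refine (expHarmonic_le_lintegral_blockSteps B R hp).trans ?_
  rw [← hsplit, expectedReward_eq_lintegral_meanReward]
  gcongr
  set c := ∫⁻ x, ENNReal.ofReal (blockSteps B R p x R) ∂unif with hc
  calc c = ∫⁻ _v : Fin n, c ∂uniformOn (Set.univ : Set (Fin n)) := by simp
    _ ≤ _ := by
      refine lintegral_mono fun v => ?_
      rw [hc]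
      refine setLIntegral_mono (measurable_meanReward _ _ B p _ _) fun x hx => ?_
      have hblocks :
          fullBlocks B R (State.init v).unexplored.card (State.init v).pending.card = R :=
        fullBlocks_self hB _
      have hle := le_meanReward_fullStepCount (p := p) hB
        (fun u hu => expHarmonic_le_div_mul_exploredCount hR hu) _ (State.valid_init v)
        (State.potential_init_le v) hx
      rwa [hblocks] at hle

end LowerBound

section Expectations

lemma integrable_natCast {Ω : Type*} [MeasurableSpace Ω] {μ : Measure Ω} {f : Ω → ℕ}
    (hf : Measurable fun ω => (f ω : ℝ≥0∞)) (h : ∫⁻ ω, f ω ∂μ ≠ ∞) :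
    Integrable (fun ω => (f ω : ℝ)) μ := by
  simpa only [ENNReal.toReal_natCast] using integrable_toReal_of_lintegral_ne_top hf.aemeasurable h

lemma integral_natCast {Ω : Type*} [MeasurableSpace Ω] {μ : Measure Ω} {f : Ω → ℕ}
    (hf : Measurable fun ω => (f ω : ℝ≥0∞)) : ∫ ω, (f ω : ℝ) ∂μ = (∫⁻ ω, f ω ∂μ).toReal := by
  simpa only [ENNReal.toReal_natCast] using
    integral_toReal hf.aemeasurable (ae_of_all μ fun ω => ENNReal.natCast_lt_top (f ω))

variable {B R : ℕ} {p : I} {M : ℝ}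

lemma measurable_natCast_stepsTotal (hB : 1 ≤ B) :
    Measurable fun ω : Sample n => (stepsTotal B ω : ℝ≥0∞) := by
  simp only [stepsTotal_eq_reward hB]
  exact (measurable_reward_init _ _ B _).const_add 1

lemma measurable_natCast_exploredTotal (hB : 1 ≤ B) :
    Measurable fun ω : Sample n => (exploredTotal B ω : ℝ≥0∞) := by
  simp only [exploredTotal_eq_reward hB]
  exact measurable_reward_init _ _ B _

lemma lintegral_stepsTotal [NeZero n] (hB : 1 ≤ B) (p : I) :
    ∫⁻ ω, stepsTotal B ω ∂sampleLaw p n = 1 + expectedReward stepCount (fun _ => 0) B p n := by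
  simp only [stepsTotal_eq_reward hB]
  rw [lintegral_add_left measurable_const, lintegral_const, measure_univ, one_mul]
  rfl

lemma lintegral_exploredTotal (hB : 1 ≤ B) (p : I) :
    ∫⁻ ω, exploredTotal B ω ∂sampleLaw p n =
      expectedReward (fun _ => 0) (exploredCount n) B p n := by
  simp only [exploredTotal_eq_reward hB]
  rfl

lemma lintegral_stepsTotal_le [NeZero n] (hB : 1 ≤ B) (hM : 0 ≤ M)
    (h : expectedReward stepCount (fun _ => 0) B p n ≤ ENNReal.ofReal M) :
    ∫⁻ ω, stepsTotal B ω ∂sampleLaw p n ≤ ENNReal.ofReal (1 + M) := by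
  rw [lintegral_stepsTotal hB, ENNReal.ofReal_add zero_le_one hM, ENNReal.ofReal_one]
  gcongr

lemma lintegral_exploredTotal_le (hB : 1 ≤ B)
    (h : expectedReward stepCount (fun _ => 0) B p n ≤ ENNReal.ofReal M) :
    ∫⁻ ω, exploredTotal B ω ∂sampleLaw p n ≤ ENNReal.ofReal (p * B * M) := by
  have hp := p.2.1
  rw [lintegral_exploredTotal hB, ENNReal.ofReal_mul (by positivity), ENNReal.ofReal_mul hp,
    ENNReal.ofReal_natCast]
  exact (expectedReward_exploredCount_le B p n).trans (by gcongr)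

/-- The lower bound for the mean number of steps that comes from the full blocks examined while
fewer than `n - R * B` vertices are explored, if `M` bounds the mean number of steps from above. -/
def stepsLowerBound (n B R : ℕ) (p M : ℝ) : ℝ :=
  expHarmonic R * (1 - 1 / (p * (B * R + 1)) - p * B * M / (n - R * B))

lemma stepsLowerBound_le_expectedReward [NeZero n] (hB : 1 ≤ B) (hp : 0 < p) (hR : R * B < n)
    (hM : 0 ≤ M) (h : expectedReward stepCount (fun _ => 0) B p n ≤ ENNReal.ofReal M) :
    ENNReal.ofReal (stepsLowerBound n B R p M) ≤
      expectedReward (fullStepCount B) (fun _ => 0) B p n := by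
  have hH := expHarmonic_pos R
  have hp' : (0 : ℝ) < p := hp
  have hnR : (0 : ℝ) < n - R * B := sub_pos.2 (by exact_mod_cast hR)
  have hexplored := lintegral_exploredTotal_le hB h
  rw [lintegral_exploredTotal hB] at hexplored
  have heq : stepsLowerBound n B R p M = expHarmonic R -
      (expHarmonic R / (n - R * B) * (p * B * M) + expHarmonic R / (p * (B * R + 1))) := by
    rw [stepsLowerBound]
    ring
  rw [heq, ENNReal.ofReal_sub _ (by positivity), tsub_le_iff_right,
    ENNReal.ofReal_add (by positivity) (by positivity), ENNReal.ofReal_mul (by positivity),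
    ← add_assoc]
  exact (expHarmonic_le_expectedReward hB hp hR).trans (by gcongr)

lemma expectedReward_fullStepCount_le (hB : 1 ≤ B) (p : I) (n : ℕ) :
    expectedReward (fullStepCount B) (fun _ => 0) B p n ≤
      expectedReward stepCount (fun _ => 0) B p n := by
  refine expectedReward_mono _ B p fun q => ?_
  rw [fullStepCount, stepCount]
  split_ifs
  · exact le_rfl
  · omega
  · exact zero_le
  · exact le_rfl

lemma stepsLowerBound_le_lintegral_stepsTotal [NeZero n] (hB : 1 ≤ B) (hp : 0 < p)
    (hR : R * B < n) (hM : 0 ≤ M)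
    (h : expectedReward stepCount (fun _ => 0) B p n ≤ ENNReal.ofReal M) :
    ENNReal.ofReal (stepsLowerBound n B R p M) ≤ ∫⁻ ω, stepsTotal B ω ∂sampleLaw p n := by
  rw [lintegral_stepsTotal hB]
  exact (stepsLowerBound_le_expectedReward hB hp hR hM h).trans
    ((expectedReward_fullStepCount_le hB p n).trans le_add_self)

lemma mul_stepsLowerBound_le_lintegral_exploredTotal [NeZero n] (hB : 1 ≤ B) (hp : 0 < p)
    (hR : R * B < n) (hM : 0 ≤ M)
    (h : expectedReward stepCount (fun _ => 0) B p n ≤ ENNReal.ofReal M) :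
    ENNReal.ofReal (p * B * stepsLowerBound n B R p M) ≤
      ∫⁻ ω, exploredTotal B ω ∂sampleLaw p n := by
  have hp' := p.2.1
  rw [lintegral_exploredTotal hB, ENNReal.ofReal_mul (by positivity), ENNReal.ofReal_mul hp',
    ENNReal.ofReal_natCast]
  refine le_trans ?_ (mul_expectedReward_fullStepCount_le B p n)
  gcongr
  exact stepsLowerBound_le_expectedReward hB hp hR hM h

end Expectations

section Asymptotics

lemma isEquivalent_of_le_of_le {ι : Type*} {f : Filter ι} {l u v w : ι → ℝ} (hl : l ~[f] w)
    (hu : u ~[f] w) (hlv : ∀ᶠ i in f, l i ≤ v i) (hvu : ∀ᶠ i in f, v i ≤ u i)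
    (hw : ∀ᶠ i in f, 0 < w i) : v ~[f] w := by
  have hne : ∀ᶠ i in f, w i ≠ 0 := hw.mono fun _ => ne_of_gt
  rw [isEquivalent_iff_tendsto_one hne] at hl hu ⊢
  refine tendsto_of_tendsto_of_tendsto_of_le_of_le' hl hu ?_ ?_
  · filter_upwards [hlv, hw] with i hi hwi using div_le_div_of_nonneg_right hi hwi.le
  · filter_upwards [hvu, hw] with i hi hwi using div_le_div_of_nonneg_right hi hwi.le

lemma isEquivalent_mul_of_tendsto_one {ι : Type*} {f : Filter ι} {a v w : ι → ℝ} (hv : v ~[f] w)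
    (ha : Tendsto a f (𝓝 1)) : (fun i => v i * a i) ~[f] w :=
  (isEquivalent_iff_exists_eq_mul.2 ⟨a, ha, .of_eq (mul_comm v a)⟩).trans hv

lemma isEquivalent_integral_natCast {ι : Type*} {f : Filter ι} {Ω : ι → Type*}
    [∀ i, MeasurableSpace (Ω i)] {μ : ∀ i, Measure (Ω i)} {T : ∀ i, Ω i → ℕ} {l u w : ι → ℝ}
    (hT : ∀ᶠ i in f, Measurable fun ω => (T i ω : ℝ≥0∞))
    (hlT : ∀ᶠ i in f, ENNReal.ofReal (l i) ≤ ∫⁻ ω, T i ω ∂μ i)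
    (hTu : ∀ᶠ i in f, ∫⁻ ω, T i ω ∂μ i ≤ ENNReal.ofReal (u i))
    (hl : l ~[f] w) (hu : u ~[f] w) (hw : ∀ᶠ i in f, 0 < w i) :
    (fun i => ∫ ω, (T i ω : ℝ) ∂μ i) ~[f] w := by
  refine isEquivalent_of_le_of_le hl hu ?_ ?_ hw
  · filter_upwards [hT, hlT, hTu] with i hmeas hle hge
    rw [integral_natCast hmeas]
    exact (ENNReal.ofReal_le_iff_le_toReal (ne_top_of_le_ne_top ENNReal.ofReal_ne_top hge)).1 hle
  · filter_upwards [hT, hTu, hu.eventually_pos hw] with i hmeas hge hpos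
    rw [integral_natCast hmeas]
    exact ENNReal.toReal_le_of_le_ofReal hpos.le hge

lemma isEquivalent_expHarmonic :
    expHarmonic ~[atTop] fun R : ℕ => Real.exp Real.eulerMascheroniConstant * R := by
  have hlim := (Real.continuous_exp.tendsto _).comp
    (Real.tendsto_harmonic_sub_log.sub_const Real.eulerMascheroniConstant)
  rw [sub_self, Real.exp_zero] at hlim
  refine isEquivalent_of_tendsto_one (hlim.congr' ?_)
  filter_upwards [eventually_gt_atTop 0] with R hR
  have : (0 : ℝ) < R := by exact_mod_cast hR
  rw [Function.comp_apply, Real.exp_sub, Real.exp_sub, Real.exp_log this, Pi.div_apply,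
    expHarmonic, div_div, mul_comm (R : ℝ)]

lemma isEquivalent_expHarmonic_comp {ι : Type*} {f : Filter ι} {R : ι → ℕ} {m : ι → ℝ}
    (hR : (fun i => (R i : ℝ)) ~[f] m) (hm : Tendsto m f atTop) :
    (fun i => expHarmonic (R i)) ~[f] fun i => Real.exp Real.eulerMascheroniConstant * m i := by
  have hRtop : Tendsto R f atTop := tendsto_natCast_atTop_iff.1 (hR.symm.tendsto_atTop hm)
  exact (isEquivalent_expHarmonic.comp_tendsto hRtop).trans (IsEquivalent.refl.mul hR)

lemma paddedBlocks_mem_Icc {B q : ℕ} (hB : 1 ≤ B) (hq : 1 ≤ q) :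
    (paddedBlocks B q : ℝ) ∈ Set.Icc ((q : ℝ) / B) (q / B + 3) := by
  have hB' : (0 : ℝ) < B := by exact_mod_cast hB
  have hlow : q ≤ paddedBlocks B q * B := by
    have := Nat.lt_div_mul_add (a := q + B - 1) (b := B) (by omega)
    rw [paddedBlocks, if_neg (by omega), add_mul]
    omega
  have hup : paddedBlocks B q * B ≤ q + 3 * B := by
    have := Nat.div_mul_le_self (q + B - 1) B
    rw [paddedBlocks, if_neg (by omega), add_mul]
    omega
  rw [Set.mem_Icc, div_le_iff₀ hB', div_add' _ _ _ hB'.ne', le_div_iff₀ hB']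
  exact ⟨by exact_mod_cast hlow, by exact_mod_cast hup⟩

/-- The number of blocks for the lower bound: slightly fewer than `n / B`, so that a number of
unexplored vertices of larger order than `n / B` is left over. -/
def lowerBlocks (n B : ℕ) : ℕ := ⌊(n : ℝ) / B * (1 - 1 / √B)⌋₊

lemma lowerBlocks_mul_le (n : ℕ) {B : ℕ} (hB : 1 ≤ B) :
    (n : ℝ) / B * √B ≤ n - lowerBlocks n B * B := by
  have hB' : (1 : ℝ) ≤ B := by exact_mod_cast hB
  have hsqrt : 1 / √(B : ℝ) ≤ 1 := div_le_one_of_le₀ (Real.one_le_sqrt.2 hB') (by positivity)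
  have hfloor : (lowerBlocks n B : ℝ) ≤ n / B * (1 - 1 / √B) :=
    Nat.floor_le (mul_nonneg (by positivity) (sub_nonneg.2 hsqrt))
  have hmul : (n : ℝ) / B * (1 - 1 / √B) * B = n - n / B * √B := by
    have hsq : (B : ℝ) / √B = √B := Real.div_sqrt
    have hpos : (0 : ℝ) < B := by linarith
    calc (n : ℝ) / B * (1 - 1 / √B) * B = n / B * B - n / B * (B / √B) := by ring
      _ = _ := by rw [hsq, div_mul_cancel₀ _ hpos.ne']
  linarith [mul_le_mul_of_nonneg_right hfloor (Nat.cast_nonneg (α := ℝ) B)]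

variable {p : ℕ → I} {B : ℕ → ℕ} {β : ℝ}

lemma tendsto_one_div_sqrt (hB : Tendsto B atTop atTop) :
    Tendsto (fun n => 1 / √(B n : ℝ)) atTop (𝓝 0) := by
  simp only [one_div]
  exact (Real.tendsto_sqrt_atTop.comp (tendsto_natCast_atTop_atTop.comp hB)).inv_tendsto_atTop

lemma isEquivalent_lowerBlocks (hB : Tendsto B atTop atTop)
    (hn : Tendsto (fun n : ℕ => (n : ℝ) / B n) atTop atTop) :
    (fun n => (lowerBlocks n (B n) : ℝ)) ~[atTop] fun n => (n : ℝ) / B n := by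
  have hone : Tendsto (fun n => 1 - 1 / √(B n : ℝ)) atTop (𝓝 1) := by
    simpa using (tendsto_one_div_sqrt hB).const_sub 1
  have harg : (fun n : ℕ => (n : ℝ) / B n * (1 - 1 / √(B n : ℝ))) ~[atTop]
      fun n => (n : ℝ) / B n := isEquivalent_mul_of_tendsto_one IsEquivalent.refl hone
  exact (isEquivalent_nat_floor (R := ℝ).comp_tendsto (harg.symm.tendsto_atTop hn)).trans harg

lemma isEquivalent_paddedBlocks (hB : ∀ᶠ n in atTop, 1 ≤ B n)
    (hn : Tendsto (fun n : ℕ => (n : ℝ) / B n) atTop atTop) :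
    (fun n => (paddedBlocks (B n) n : ℝ)) ~[atTop] fun n => (n : ℝ) / B n := by
  have hmem : ∀ᶠ n : ℕ in atTop,
      (paddedBlocks (B n) n : ℝ) ∈ Set.Icc ((n : ℝ) / B n) (n / B n + 3) :=
    (hB.and (eventually_ge_atTop 1)).mono fun n h => paddedBlocks_mem_Icc h.1 h.2
  exact isEquivalent_of_le_of_le IsEquivalent.refl
    (IsEquivalent.refl.add_const_of_norm_tendsto_atTop (tendsto_norm_atTop_atTop.comp hn))
    (hmem.mono fun n h => h.1) (hmem.mono fun n h => h.2) (hn.eventually_gt_atTop 0)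

lemma exp_le_one_sub_pow {p : ℝ} (hp₀ : 0 ≤ p) (hp : p ≤ 1 / 2) (b : ℕ) :
    Real.exp (-2 * (p * b)) ≤ (1 - p) ^ b := by
  have hpos : 0 < 1 - p := by linarith
  have hinv : (1 - p)⁻¹ ≤ 1 + 2 * p := by
    rw [inv_le_iff_one_le_mul₀ hpos]
    nlinarith
  have hexp : Real.exp (-2 * p) ≤ 1 - p := by
    rw [← Real.le_log_iff_exp_le hpos]
    linarith [Real.one_sub_inv_le_log_of_pos hpos]
  calc Real.exp (-2 * (p * b)) = Real.exp (-2 * p) ^ b := by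
        rw [← Real.exp_nat_mul]
        ring_nf
    _ ≤ _ := pow_le_pow_left₀ (Real.exp_nonneg _) hexp b

lemma eventually_three_le {m : ℕ → ℝ} (hB : Tendsto B atTop atTop)
    (hpB : Tendsto (fun n => (p n : ℝ) * B n) atTop (𝓝 β)) (hm : Tendsto m atTop atTop) :
    ∀ᶠ n in atTop, 3 ≤ (1 - (p n : ℝ)) ^ B n * m n := by
  have hBtop : Tendsto (fun n => (B n : ℝ)) atTop atTop := tendsto_natCast_atTop_atTop.comp hB
  have hp : Tendsto (fun n => (p n : ℝ)) atTop (𝓝 0) := by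
    refine (hpB.div_atTop hBtop).congr' ?_
    filter_upwards [hBtop.eventually_gt_atTop 0] with n hBn
    exact mul_div_cancel_right₀ _ hBn.ne'
  have hexp : Tendsto (fun n => Real.exp (-2 * (p n * B n)) * m n) atTop atTop :=
    ((Real.continuous_exp.tendsto _).comp (hpB.const_mul (-2))).pos_mul_atTop (Real.exp_pos _) hm
  filter_upwards [hexp.eventually_ge_atTop 3, hp.eventually (gt_mem_nhds one_half_pos),
    hm.eventually_ge_atTop 0] with n hge hpn hmn
  exact hge.trans (mul_le_mul_of_nonneg_right (exp_le_one_sub_pow (p n).2.1 hpn.le _) hmn)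

lemma tendsto_one_div_mul_add_one {R : ℕ → ℕ} (hβ : 0 < β)
    (hpB : Tendsto (fun n => (p n : ℝ) * B n) atTop (𝓝 β)) (hR : Tendsto R atTop atTop) :
    Tendsto (fun n => 1 / ((p n : ℝ) * (B n * R n + 1))) atTop (𝓝 0) := by
  have htop : Tendsto (fun n => (p n : ℝ) * B n * R n + p n) atTop atTop :=
    tendsto_atTop_mono (fun n => le_add_of_nonneg_right (p n).2.1)
      (hpB.pos_mul_atTop hβ (tendsto_natCast_atTop_atTop.comp hR))
  refine htop.inv_tendsto_atTop.congr fun n => ?_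
  rw [Pi.inv_apply, one_div]
  ring_nf

lemma tendsto_mul_div_sub_lowerBlocks {M : ℕ → ℝ} (hB : Tendsto B atTop atTop)
    (hpB : Tendsto (fun n => (p n : ℝ) * B n) atTop (𝓝 β))
    (hn : Tendsto (fun n : ℕ => (n : ℝ) / B n) atTop atTop)
    (hM₀ : ∀ n, 0 ≤ M n) {c : ℝ} (hM : M ~[atTop] fun n => c * ((n : ℝ) / B n)) :
    Tendsto (fun n => (p n : ℝ) * B n * M n / (n - lowerBlocks n (B n) * B n)) atTop (𝓝 0) := by
  have hratio : Tendsto (fun n => M n / ((n : ℝ) / B n)) atTop (𝓝 c) := by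
    have := hM.div (IsEquivalent.refl (u := fun n : ℕ => (n : ℝ) / B n))
    refine (this.trans_eventuallyEq ?_).tendsto_const
    filter_upwards [hn.eventually_gt_atTop 0] with n hpos
    exact mul_div_cancel_right₀ c hpos.ne'
  have hlim := (hpB.mul hratio).mul (tendsto_one_div_sqrt hB)
  rw [mul_zero] at hlim
  have hle : ∀ᶠ n : ℕ in atTop, 0 < (n : ℝ) / B n * √(B n) ∧
      (n : ℝ) / B n * √(B n) ≤ n - lowerBlocks n (B n) * B n := by
    filter_upwards [hB.eventually_ge_atTop 1, hn.eventually_gt_atTop 0] with n hBn hpos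
    have : (0 : ℝ) < B n := by exact_mod_cast hBn
    exact ⟨by positivity, lowerBlocks_mul_le n hBn⟩
  have hnum (n : ℕ) : 0 ≤ (p n : ℝ) * B n * M n :=
    mul_nonneg (mul_nonneg (p n).2.1 (Nat.cast_nonneg _)) (hM₀ n)
  refine tendsto_of_tendsto_of_tendsto_of_le_of_le' tendsto_const_nhds hlim ?_ ?_
  · filter_upwards [hle] with n h using div_nonneg (hnum n) (h.1.le.trans h.2)
  · filter_upwards [hle] with n h
    calc _ ≤ (p n : ℝ) * B n * M n / ((n : ℝ) / B n * √(B n)) :=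
          div_le_div_of_nonneg_left (hnum n) h.1 h.2
      _ = _ := by rw [mul_div_assoc, mul_one_div, mul_div_assoc, div_div]

lemma isEquivalent_stepsLowerBound {M : ℕ → ℝ} (hβ : 0 < β) (hB : Tendsto B atTop atTop)
    (hpB : Tendsto (fun n => (p n : ℝ) * B n) atTop (𝓝 β))
    (hn : Tendsto (fun n : ℕ => (n : ℝ) / B n) atTop atTop)
    (hM₀ : ∀ n, 0 ≤ M n) {c : ℝ} (hM : M ~[atTop] fun n => c * ((n : ℝ) / B n)) :
    (fun n => stepsLowerBound n (B n) (lowerBlocks n (B n)) (p n) (M n)) ~[atTop]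
      fun n => Real.exp Real.eulerMascheroniConstant * ((n : ℝ) / B n) := by
  have hR := isEquivalent_lowerBlocks hB hn
  have hRtop : Tendsto (fun n => lowerBlocks n (B n)) atTop atTop :=
    tendsto_natCast_atTop_iff.1 (hR.symm.tendsto_atTop hn)
  have hone : Tendsto (fun n => 1 - 1 / ((p n : ℝ) * (B n * lowerBlocks n (B n) + 1)) -
      p n * B n * M n / (n - lowerBlocks n (B n) * B n)) atTop (𝓝 1) := by
    simpa only [sub_zero] using ((tendsto_one_div_mul_add_one hβ hpB hRtop).const_sub 1).sub
      (tendsto_mul_div_sub_lowerBlocks hB hpB hn hM₀ hM)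
  exact isEquivalent_mul_of_tendsto_one (isEquivalent_expHarmonic_comp hR hn) hone

end Asymptotics

section MainAsymptotics

variable {p : ℕ → I} {B : ℕ → ℕ} {β : ℝ}

lemma isEquivalent_expHarmonic_paddedBlocks (hB : Tendsto B atTop atTop)
    (hn : Tendsto (fun n : ℕ => (n : ℝ) / B n) atTop atTop) :
    (fun n => expHarmonic (paddedBlocks (B n) n)) ~[atTop]
      fun n => Real.exp Real.eulerMascheroniConstant * ((n : ℝ) / B n) :=
  isEquivalent_expHarmonic_comp (isEquivalent_paddedBlocks (hB.eventually_ge_atTop 1) hn) hn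

lemma eventually_expectedReward_stepCount_le (hB : Tendsto B atTop atTop)
    (hpB : Tendsto (fun n => (p n : ℝ) * B n) atTop (𝓝 β))
    (hn : Tendsto (fun n : ℕ => (n : ℝ) / B n) atTop atTop) :
    ∀ᶠ n in atTop, expectedReward stepCount (fun _ => 0) (B n) (p n) n ≤
      ENNReal.ofReal (expHarmonic (paddedBlocks (B n) n)) := by
  have hM : Tendsto (fun n => expHarmonic (paddedBlocks (B n) n)) atTop atTop :=
    (isEquivalent_expHarmonic_paddedBlocks hB hn).symm.tendsto_atTop
      (hn.const_mul_atTop (Real.exp_pos _))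
  filter_upwards [hB.eventually_ge_atTop 1, eventually_three_le hB hpB hM,
    eventually_gt_atTop 0] with n hBn hthree hpos
  have : NeZero n := ⟨hpos.ne'⟩
  exact expectedReward_stepCount_le hBn le_rfl hthree

lemma eventually_lowerBlocks_mul_lt (hB : Tendsto B atTop atTop)
    (hn : Tendsto (fun n : ℕ => (n : ℝ) / B n) atTop atTop) :
    ∀ᶠ n in atTop, lowerBlocks n (B n) * B n < n := by
  filter_upwards [hB.eventually_ge_atTop 1, hn.eventually_gt_atTop 0] with n hBn hpos
  have : (0 : ℝ) < B n := by exact_mod_cast hBn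
  have hleft : (0 : ℝ) < n - lowerBlocks n (B n) * B n :=
    lt_of_lt_of_le (by positivity) (lowerBlocks_mul_le n hBn)
  exact_mod_cast sub_pos.1 hleft

lemma eventually_integrable_total (hB : Tendsto B atTop atTop)
    (hpB : Tendsto (fun n => (p n : ℝ) * B n) atTop (𝓝 β))
    (hn : Tendsto (fun n : ℕ => (n : ℝ) / B n) atTop atTop) :
    ∀ᶠ n in atTop, Integrable (fun ω => (stepsTotal (B n) ω : ℝ)) (sampleLaw (p n) n) ∧
      Integrable (fun ω => (exploredTotal (B n) ω : ℝ)) (sampleLaw (p n) n) := by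
  filter_upwards [hB.eventually_ge_atTop 1, eventually_expectedReward_stepCount_le hB hpB hn,
    eventually_gt_atTop 0] with n hBn hle hpos
  have : NeZero n := ⟨hpos.ne'⟩
  exact ⟨integrable_natCast (measurable_natCast_stepsTotal hBn) (ne_top_of_le_ne_top
      ENNReal.ofReal_ne_top (lintegral_stepsTotal_le hBn (expHarmonic_pos _).le hle)),
    integrable_natCast (measurable_natCast_exploredTotal hBn) (ne_top_of_le_ne_top
      ENNReal.ofReal_ne_top (lintegral_exploredTotal_le hBn hle))⟩

lemma eventually_stepsLowerBound_le (hβ : 0 < β) (hB : Tendsto B atTop atTop)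
    (hpB : Tendsto (fun n => (p n : ℝ) * B n) atTop (𝓝 β))
    (hn : Tendsto (fun n : ℕ => (n : ℝ) / B n) atTop atTop) :
    ∀ᶠ n in atTop,
      ENNReal.ofReal (stepsLowerBound n (B n) (lowerBlocks n (B n)) (p n)
        (expHarmonic (paddedBlocks (B n) n))) ≤
          ∫⁻ ω, stepsTotal (B n) ω ∂sampleLaw (p n) n ∧
      ENNReal.ofReal (p n * B n * stepsLowerBound n (B n) (lowerBlocks n (B n)) (p n)
        (expHarmonic (paddedBlocks (B n) n))) ≤
          ∫⁻ ω, exploredTotal (B n) ω ∂sampleLaw (p n) n := by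
  filter_upwards [hB.eventually_ge_atTop 1, eventually_expectedReward_stepCount_le hB hpB hn,
    eventually_lowerBlocks_mul_lt hB hn, hpB.eventually (lt_mem_nhds hβ),
    eventually_gt_atTop 0] with n hBn hle hlt hpBn hpos
  have : NeZero n := ⟨hpos.ne'⟩
  have hpn : 0 < p n := pos_of_mul_pos_left (b := (B n : ℝ)) hpBn (Nat.cast_nonneg _)
  have hM := (expHarmonic_pos (paddedBlocks (B n) n)).le
  exact ⟨stepsLowerBound_le_lintegral_stepsTotal hBn hpn hlt hM hle,
    mul_stepsLowerBound_le_lintegral_exploredTotal hBn hpn hlt hM hle⟩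

lemma isEquivalent_integral_stepsTotal (hβ : 0 < β) (hB : Tendsto B atTop atTop)
    (hpB : Tendsto (fun n => (p n : ℝ) * B n) atTop (𝓝 β))
    (hn : Tendsto (fun n : ℕ => (n : ℝ) / B n) atTop atTop) :
    (fun n => ∫ ω, (stepsTotal (B n) ω : ℝ) ∂sampleLaw (p n) n) ~[atTop]
      fun n => Real.exp Real.eulerMascheroniConstant * ((n : ℝ) / B n) := by
  have hM := isEquivalent_expHarmonic_paddedBlocks hB hn
  have htop : Tendsto (fun n : ℕ => Real.exp Real.eulerMascheroniConstant * ((n : ℝ) / B n))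
      atTop atTop := hn.const_mul_atTop (Real.exp_pos _)
  refine isEquivalent_integral_natCast
    ((hB.eventually_ge_atTop 1).mono fun n hBn => measurable_natCast_stepsTotal hBn)
    ((eventually_stepsLowerBound_le hβ hB hpB hn).mono fun n h => h.1) ?_
    (isEquivalent_stepsLowerBound hβ hB hpB hn (fun n => (expHarmonic_pos _).le) hM)
    (hM.const_add_of_norm_tendsto_atTop (c := 1) (tendsto_norm_atTop_atTop.comp htop))
    (htop.eventually_gt_atTop 0)
  filter_upwards [hB.eventually_ge_atTop 1, eventually_expectedReward_stepCount_le hB hpB hn,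
    eventually_gt_atTop 0] with n hBn hle hpos
  have : NeZero n := ⟨hpos.ne'⟩
  exact lintegral_stepsTotal_le hBn (expHarmonic_pos _).le hle

lemma isEquivalent_integral_exploredTotal (hβ : 0 < β) (hB : Tendsto B atTop atTop)
    (hpB : Tendsto (fun n => (p n : ℝ) * B n) atTop (𝓝 β))
    (hn : Tendsto (fun n : ℕ => (n : ℝ) / B n) atTop atTop) :
    (fun n => ∫ ω, (exploredTotal (B n) ω : ℝ) ∂sampleLaw (p n) n) ~[atTop]
      fun n => β * Real.exp Real.eulerMascheroniConstant * ((n : ℝ) / B n) := by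
  simp only [mul_assoc]
  have hM := isEquivalent_expHarmonic_paddedBlocks hB hn
  have hpB' := (isEquivalent_const_iff_tendsto hβ.ne').2 hpB
  refine isEquivalent_integral_natCast
    ((hB.eventually_ge_atTop 1).mono fun n hBn => measurable_natCast_exploredTotal hBn)
    ((eventually_stepsLowerBound_le hβ hB hpB hn).mono fun n h => h.2) ?_
    (hpB'.mul
      (isEquivalent_stepsLowerBound hβ hB hpB hn (fun n => (expHarmonic_pos _).le) hM))
    (hpB'.mul hM) ?_
  · filter_upwards [hB.eventually_ge_atTop 1,
      eventually_expectedReward_stepCount_le hB hpB hn] with n hBn hle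
    exact lintegral_exploredTotal_le hBn hle
  · filter_upwards [hn.eventually_gt_atTop 0] with n hpos
    positivity

end MainAsymptotics

section PowerLaw

variable {lam α β : ℝ} {B : ℕ → ℕ}

lemma tendsto_natCast_rpow_atTop {s : ℝ} (hs : 0 < s) :
    Tendsto (fun n : ℕ => (n : ℝ) ^ s) atTop atTop :=
  (tendsto_rpow_atTop hs).comp tendsto_natCast_atTop_atTop

lemma eventuallyEq_edgeProb (hlam : 0 < lam) (hα : 0 < α) :
    (fun n => (edgeProb lam α n : ℝ)) =ᶠ[atTop] fun n => lam * (n : ℝ) ^ (-α) := by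
  have hlim : Tendsto (fun n : ℕ => lam * (n : ℝ) ^ (-α)) atTop (𝓝 (lam * 0)) :=
    ((tendsto_rpow_neg_atTop hα).comp tendsto_natCast_atTop_atTop).const_mul lam
  rw [mul_zero] at hlim
  filter_upwards [hlim.eventually (gt_mem_nhds zero_lt_one)] with n hn
  rw [edgeProb, Set.coe_projIcc, min_eq_right hn.le, max_eq_right (by positivity)]

lemma tendsto_blockSize (hlam : 0 < lam) (hα : 0 < α) (hβ : 0 < β)
    (hB : (fun n => (B n : ℝ)) ~[atTop] fun n => β * lam⁻¹ * (n : ℝ) ^ α) :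
    Tendsto B atTop atTop :=
  tendsto_natCast_atTop_iff.1 (hB.symm.tendsto_atTop
    ((tendsto_natCast_rpow_atTop hα).const_mul_atTop (by positivity)))

lemma tendsto_edgeProb_mul_blockSize (hlam : 0 < lam) (hα : 0 < α)
    (hB : (fun n => (B n : ℝ)) ~[atTop] fun n => β * lam⁻¹ * (n : ℝ) ^ α) :
    Tendsto (fun n => (edgeProb lam α n : ℝ) * B n) atTop (𝓝 β) := by
  refine ((IsEquivalent.refl.mul hB).trans_eventuallyEq ?_).tendsto_const
  filter_upwards [eventuallyEq_edgeProb hlam hα, eventually_gt_atTop 0] with n hp hn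
  have hn' : (0 : ℝ) < n := by exact_mod_cast hn
  rw [Pi.mul_apply, hp, Real.rpow_neg hn'.le, Function.const_apply]
  field_simp

lemma isEquivalent_div_blockSize
    (hB : (fun n => (B n : ℝ)) ~[atTop] fun n => β * lam⁻¹ * (n : ℝ) ^ α) :
    (fun n : ℕ => (n : ℝ) / B n) ~[atTop] fun n => lam / β * (n : ℝ) ^ (1 - α) := by
  refine (IsEquivalent.refl.div hB).trans_eventuallyEq ?_
  filter_upwards [eventually_gt_atTop 0] with n hn
  have hn' : (0 : ℝ) < n := by exact_mod_cast hn
  rw [Pi.div_apply, Real.rpow_sub hn', Real.rpow_one, ← div_div, ← div_eq_mul_inv, mul_div_assoc']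
  field_simp

lemma tendsto_div_blockSize (hlam : 0 < lam) (hα : α < 1) (hβ : 0 < β)
    (hB : (fun n => (B n : ℝ)) ~[atTop] fun n => β * lam⁻¹ * (n : ℝ) ^ α) :
    Tendsto (fun n : ℕ => (n : ℝ) / B n) atTop atTop :=
  (isEquivalent_div_blockSize hB).symm.tendsto_atTop
    ((tendsto_natCast_rpow_atTop (sub_pos.2 hα)).const_mul_atTop (div_pos hlam hβ))

lemma isEquivalent_const_mul_div_blockSize {c d : ℝ} (hcd : c * (lam / β) = d)
    (hB : (fun n => (B n : ℝ)) ~[atTop] fun n => β * lam⁻¹ * (n : ℝ) ^ α) :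
    (fun n : ℕ => c * ((n : ℝ) / B n)) ~[atTop] fun n => d * (n : ℝ) ^ (1 - α) := by
  simp only [← hcd, mul_assoc]
  exact IsEquivalent.refl.mul (isEquivalent_div_blockSize hB)

end PowerLaw

end AGD

end

theorem mainTheorem2_general {p : ℕ → I} {B : ℕ → ℕ} {β : ℝ} (hβ : 0 < β)
    (hB : Tendsto B atTop atTop)
    (hpB : Tendsto (fun n => (p n : ℝ) * B n) atTop (𝓝 β))
    (hn : Tendsto (fun n : ℕ => (n : ℝ) / B n) atTop atTop) :
    (∀ᶠ n in atTop,
      (∀ᵐ ω ∂AGD.sampleLaw (p n) n, (AGD.stoppingSet (B n) ω).Nonempty) ∧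
      Integrable (fun ω => (AGD.stepsTotal (B n) ω : ℝ)) (AGD.sampleLaw (p n) n) ∧
      Integrable (fun ω => (AGD.exploredTotal (B n) ω : ℝ)) (AGD.sampleLaw (p n) n)) ∧
    ((fun n => ∫ ω, (AGD.stepsTotal (B n) ω : ℝ) ∂AGD.sampleLaw (p n) n) ~[atTop]
      fun n => Real.exp Real.eulerMascheroniConstant * ((n : ℝ) / B n)) ∧
    ((fun n => ∫ ω, (AGD.exploredTotal (B n) ω : ℝ) ∂AGD.sampleLaw (p n) n) ~[atTop]
      fun n => β * Real.exp Real.eulerMascheroniConstant * ((n : ℝ) / B n)) := by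
  refine ⟨?_, AGD.isEquivalent_integral_stepsTotal hβ hB hpB hn,
    AGD.isEquivalent_integral_exploredTotal hβ hB hpB hn⟩
  filter_upwards [hB.eventually_ge_atTop 1, AGD.eventually_integrable_total hB hpB hn]
    with n hBn hintegrable
  exact ⟨ae_of_all _ fun ω => ⟨_, AGD.exhaustionTime_succ_mem_stoppingSet hBn ω⟩, hintegrable⟩

theorem mainTheorem2 (lam α β : ℝ) (hlam : 0 < lam) (hα₀ : 0 < α) (hα₁ : α < 1) (hβ : 0 < β)
    (B : ℕ → ℕ)
    (hB : (fun n : ℕ => (B n : ℝ)) ~[atTop] fun n : ℕ => β * lam⁻¹ * (n : ℝ) ^ α) :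
    (∀ᶠ n : ℕ in atTop,
      (∀ᵐ ω ∂(AGD.law lam α n), (AGD.stoppingSet (B n) ω).Nonempty) ∧
      Integrable (fun ω => (AGD.stepsTotal (B n) ω : ℝ)) (AGD.law lam α n) ∧
      Integrable (fun ω => (AGD.exploredTotal (B n) ω : ℝ)) (AGD.law lam α n)) ∧
    ((fun n : ℕ => ∫ ω, (AGD.stepsTotal (B n) ω : ℝ) ∂(AGD.law lam α n)) ~[atTop]
      fun n : ℕ =>
        lam / β * Real.exp Real.eulerMascheroniConstant * (n : ℝ) ^ (1 - α)) ∧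
    ((fun n : ℕ => ∫ ω, (AGD.exploredTotal (B n) ω : ℝ) ∂(AGD.law lam α n)) ~[atTop]
      fun n : ℕ =>
        lam * Real.exp Real.eulerMascheroniConstant * (n : ℝ) ^ (1 - α)) := by
  obtain ⟨hfinite, hsteps, hexplored⟩ := mainTheorem2_general hβ
    (AGD.tendsto_blockSize hlam hα₀ hβ hB) (AGD.tendsto_edgeProb_mul_blockSize hlam hα₀ hB)
    (AGD.tendsto_div_blockSize hlam hα₁ hβ hB)
  exact ⟨hfinite,
    hsteps.trans (AGD.isEquivalent_const_mul_div_blockSize (mul_comm _ _) hB),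
    hexplored.trans (AGD.isEquivalent_const_mul_div_blockSize (by field_simp) hB)⟩
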